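/- Let $n\ge 2$, let $1\le p<\infty$ be real, and let $(\Omega,P)$ be a probability space. For a random vector $\mathbf y=(y_1,\dots,y_n)$ with differentiable joint density $p_{\mathbf y}$ and differentiable marginal densities $p_{y_i}$, the gradient function difference (GFD) of $\mathbf y$ is $$\boldsymbol\alpha_{\mathbf y}=\nabla\Big(\prod_{i=1}^n p_{y_i}(y_i)\Big)-\nabla p_{\mathbf y}(y_1,\dots,y_n)=(\alpha_{\mathbf y,1},\dots,\alpha_{\mathbf y,n}),$$ and its $L^p$ norm is $\|\boldsymbol\alpha_{\mathbf y}\|_p=\big(\sum_{i=1}^n\int_{\mathbb R^n}|\alpha_{\mathbf y,i}|^p\big)^{1/p}$. Let $\mathbf z$ be the normalization of $\mathbf y$, $z_i=(y_i-\mathbb E y_i)/\sigma_{y_i}$ (zero mean, unit variance), and put $$\Phi_p(\mathbf y)=-\|\boldsymbol\alpha_{\mathbf z}\|_p,\qquad \Psi_p(\mathbf y)=-\|\boldsymbol\alpha_{\mathbf y}\|_p\quad\text{(without normalization)}.$$ Let $\mathcal H$ be the set of invertible real $n\times n$ matrices and $\mathcal T\subset\mathcal H$ the set of products of an invertible diagonal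 matrix and a permutation matrix (the trivial filters). Call a random vector $\mathbf s$ on $\Omega$ an admissible source if its components are independent and of finite variance, at most one of them is Gaussian, and for every $\mathbf H\in\mathcal H$ the vector $\mathbf{Hs}$ has differentiable joint and marginal densities and a GFD with components in $L^p(\mathbb R^n)$ (so that the criteria are defined and finite). For a set $\mathcal S$ of admissible sources let $\mathcal X=\{\mathbf{Hs}:\mathbf H\in\mathcal H,\ \mathbf s\in\mathcal S\}$. A map $\Phi(\mathbf H;\mathbf x)$ is a contrast (for linear blind source separation, BSS) if it depends on $\mathbf x\in\mathcal X$ only through the distribution of $\mathbf x$ and satisfies * invariance: $\Phi(\mathbf T;\mathbf x)=\Phi(\mathbf I;\mathbf x)$ for all $\mathbf x\in\mathcal X$, $\mathbf T\in\mathcal T$; * dominance: $\Phi(\mathbf H;\mathbf s)\le\Phi(\mathbf I;\mathbf s)$ for all $\mathbf s\in\mathcal S$, $\mathbf H\in\mathcal H$; * discrimination: if $\mathbf s\in\mathcal S$, $\mathbf H\in\mathcal H$ and $\Phi(\mathbf H;\mathbf s)=\Phi(\mathbf I;\mathbf s)$, then $\mathbf H\in\mathcal T$. Then: 1. Every random vector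 with independent components of finite variance, at most one of them Gaussian, whose components have differentiable densities with derivatives in $L^p(\mathbb R)$, is an admissible source. 2. For every set $\mathcal S$ of admissible sources, $\Phi_p(\mathbf H;\mathbf x)=\Phi_p(\mathbf{Hx})$ is a contrast. 3. For every non-empty set $\mathcal S$ of admissible sources, $\Psi_p$ is neither scale invariant nor relatively scale invariant on $\mathcal X$: it is not true that $\Psi_p(\boldsymbol\Lambda\mathbf x)=\Psi_p(\mathbf x)$ for all $\mathbf x\in\mathcal X$ and all invertible diagonal $\boldsymbol\Lambda$, and there is no function $k$ of $\boldsymbol\Lambda$ alone such that $\Psi_p(\boldsymbol\Lambda\mathbf x)=k(\boldsymbol\Lambda)\Psi_p(\mathbf x)$ for all such $\mathbf x$ and $\boldsymbol\Lambda$. In particular $\Psi_p(\mathbf H;\mathbf x)=\Psi_p(\mathbf{Hx})$ is not a contrast. -/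

import Mathlib

open MeasureTheory ProbabilityTheory

namespace BSS

noncomputable section

/-- `f` is a differentiable probability density function of the law `μ`. -/
def IsDiffPDF {E : Type*} [NormedAddCommGroup E] [NormedSpace ℝ E] [MeasureSpace E]
    (μ : Measure E) (f : E → ℝ) : Prop :=
  Differentiable ℝ f ∧ (∀ x, 0 ≤ f x) ∧
    μ = (volume : Measure E).withDensity (fun x => ENNReal.ofReal (f x))

open Classical in
/-- The differentiable density of `μ` (it is unique, see `diffPDF_eq`); the junk value `0` if
`μ` has no differentiable density. -/
def diffPDF {E : Type*} [NormedAddCommGroup E] [NormedSpace ℝ E] [MeasureSpace E]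
    (μ : Measure E) : E → ℝ :=
  if h : ∃ f : E → ℝ, IsDiffPDF μ f then h.choose else 0

theorem IsDiffPDF.unique {E : Type*} [NormedAddCommGroup E] [NormedSpace ℝ E] [MeasureSpace E]
    [BorelSpace E] [SigmaFinite (volume : Measure E)]
    [(volume : Measure E).IsOpenPosMeasure] {μ : Measure E}
    {f g : E → ℝ} (hf : IsDiffPDF μ f) (hg : IsDiffPDF μ g) : f = g := by
  obtain ⟨hfd, hf0, hf⟩ := hf
  obtain ⟨hgd, hg0, hg⟩ := hg
  have hfm : Measurable fun x => ENNReal.ofReal (f x) := hfd.continuous.measurable.ennreal_ofReal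
  have hgm : Measurable fun x => ENNReal.ofReal (g x) := hgd.continuous.measurable.ennreal_ofReal
  have hae := (withDensity_eq_iff_of_sigmaFinite hfm.aemeasurable hgm.aemeasurable).1
    (hf.symm.trans hg)
  refine Continuous.ae_eq_iff_eq (volume : Measure E) hfd.continuous hgd.continuous |>.1 ?_
  filter_upwards [hae] with x hx
  exact (ENNReal.ofReal_eq_ofReal_iff (hf0 x) (hg0 x)).1 hx

theorem diffPDF_eq {E : Type*} [NormedAddCommGroup E] [NormedSpace ℝ E] [MeasureSpace E]
    [BorelSpace E] [SigmaFinite (volume : Measure E)]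
    [(volume : Measure E).IsOpenPosMeasure] {μ : Measure E}
    {f : E → ℝ} (hf : IsDiffPDF μ f) : diffPDF μ = f := by
  have h : ∃ f : E → ℝ, IsDiffPDF μ f := ⟨f, hf⟩
  rw [diffPDF, dif_pos h]
  exact h.choose_spec.unique hf

/-- The `i`-th marginal of a law on `ℝⁿ`. -/
def marginal {n : ℕ} (μ : Measure (Fin n → ℝ)) (i : Fin n) : Measure ℝ :=
  μ.map (fun x => x i)

/-- The joint density of a law on `ℝⁿ`. -/
def jointPDF {n : ℕ} (μ : Measure (Fin n → ℝ)) (x : Fin n → ℝ) : ℝ := diffPDF μ x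

/-- The product of the marginal densities of a law on `ℝⁿ`. -/
def prodPDF {n : ℕ} (μ : Measure (Fin n → ℝ)) (x : Fin n → ℝ) : ℝ :=
  ∏ i, diffPDF (marginal μ i) (x i)

/-- `ξ_i`: the `i`-th partial derivative of the product of the marginal densities (GPF). -/
def gpf {n : ℕ} (μ : Measure (Fin n → ℝ)) (i : Fin n) (x : Fin n → ℝ) : ℝ :=
  fderiv ℝ (prodPDF μ) x (Pi.single i 1)

/-- `ζ_i`: the `i`-th partial derivative of the joint density (GJF). -/
def gjf {n : ℕ} (μ : Measure (Fin n → ℝ)) (i : Fin n) (x : Fin n → ℝ) : ℝ :=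
  fderiv ℝ (jointPDF μ) x (Pi.single i 1)

/-- `α_i = ξ_i - ζ_i`: the `i`-th component of the gradient function difference (GFD). -/
def gfd {n : ℕ} (μ : Measure (Fin n → ℝ)) (i : Fin n) (x : Fin n → ℝ) : ℝ :=
  gpf μ i x - gjf μ i x

/-- The `Lᵖ` norm of the GFD, `(∑ i, ∫ |α_i|ᵖ)^(1/p)`. -/
def gfdNorm {n : ℕ} (p : ℝ) (μ : Measure (Fin n → ℝ)) : ℝ :=
  (∑ i, ∫ x, |gfd μ i x| ^ p) ^ (1 / p)

/-- The law `μ` on `ℝⁿ` has differentiable joint and marginal densities, and a GFD of finite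
`Lᵖ` norm. -/
structure HasLpGFD {n : ℕ} (p : ℝ) (μ : Measure (Fin n → ℝ)) : Prop where
  joint : ∃ f : (Fin n → ℝ) → ℝ, IsDiffPDF μ f
  marg : ∀ i, ∃ f : ℝ → ℝ, IsDiffPDF (marginal μ i) f
  memLp : ∀ i, MemLp (gfd μ i) (ENNReal.ofReal p) volume

/-- The random vector `ω ↦ H x(ω)`. -/
def mix {Ω : Type*} {n : ℕ} (H : Matrix (Fin n) (Fin n) ℝ) (x : Ω → Fin n → ℝ) :
    Ω → Fin n → ℝ :=
  fun ω => H.mulVec (x ω)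

/-- The normalized random vector, whose components are `(x_i - E x_i) / σ(x_i)`. -/
def normalize {Ω : Type*} [MeasurableSpace Ω] (P : Measure Ω) {n : ℕ} (x : Ω → Fin n → ℝ) :
    Ω → Fin n → ℝ :=
  fun ω i => (x ω i - ∫ ω', x ω' i ∂P) / Real.sqrt (variance (fun ω' => x ω' i) P)

/-- `Φ(x)`: minus the `Lᵖ` norm of the GFD of the normalized random vector. -/
def gfdCriterion {Ω : Type*} [MeasurableSpace Ω] (P : Measure Ω) {n : ℕ} (p : ℝ)
    (x : Ω → Fin n → ℝ) : ℝ :=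
  - gfdNorm p (P.map (normalize P x))

/-- Minus the `Lᵖ` norm of the GFD of `x` itself, without normalization. -/
def rawGFDCriterion {Ω : Type*} [MeasurableSpace Ω] (P : Measure Ω) {n : ℕ} (p : ℝ)
    (x : Ω → Fin n → ℝ) : ℝ :=
  - gfdNorm p (P.map x)

/-- The filters of linear BSS: the invertible matrices. -/
def linearFilters (n : ℕ) : Set (Matrix (Fin n) (Fin n) ℝ) := {H | H.det ≠ 0}

/-- The trivial filters of linear BSS: an invertible diagonal scaling times a permutation. -/
def trivialFilters (n : ℕ) : Set (Matrix (Fin n) (Fin n) ℝ) :=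
  {T | ∃ (d : Fin n → ℝ) (σ : Equiv.Perm (Fin n)), (∀ i, d i ≠ 0) ∧
    T = Matrix.diagonal d * σ.permMatrix ℝ}

/-- `ℋ · 𝒮`: the random vectors obtained by the action of the filters on the sources. -/
def mixtures {Ω : Type*} {n : ℕ} (ℋ : Set (Matrix (Fin n) (Fin n) ℝ))
    (𝒮 : Set (Ω → Fin n → ℝ)) : Set (Ω → Fin n → ℝ) :=
  {x | ∃ H ∈ ℋ, ∃ s ∈ 𝒮, x = mix H s}

/-- `Φ(H; x)` is a contrast for the filters `ℋ`, the independent sources `𝒮` and the trivial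
filters `𝒯`: it depends solely on the law of `x`, and has the properties of invariance, dominance
and discrimination. -/
structure IsContrast {Ω : Type*} [MeasurableSpace Ω] (P : Measure Ω) {n : ℕ}
    (ℋ 𝒯 : Set (Matrix (Fin n) (Fin n) ℝ)) (𝒮 : Set (Ω → Fin n → ℝ))
    (Φ : Matrix (Fin n) (Fin n) ℝ → (Ω → Fin n → ℝ) → ℝ) : Prop where
  one_mem : 1 ∈ ℋ
  trivial_subset : 𝒯 ⊆ ℋ
  sources_indep : ∀ s ∈ 𝒮, iIndepFun (fun (i : Fin n) (ω : Ω) => s ω i) P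
  law_only : ∀ H ∈ ℋ, ∀ x ∈ mixtures ℋ 𝒮, ∀ x' ∈ mixtures ℋ 𝒮, P.map x = P.map x' →
    Φ H x = Φ H x'
  invariance : ∀ x ∈ mixtures ℋ 𝒮, ∀ T ∈ 𝒯, Φ T x = Φ 1 x
  dominance : ∀ s ∈ 𝒮, ∀ H ∈ ℋ, Φ H s ≤ Φ 1 s
  discrimination : ∀ s ∈ 𝒮, ∀ H ∈ ℋ, Φ H s = Φ 1 s → H ∈ 𝒯

/-- `Ψ(Λ x) = Ψ(x)` for all `x ∈ 𝒳` and all invertible diagonal `Λ`. -/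
def IsScaleInvariant {Ω : Type*} {n : ℕ} (𝒳 : Set (Ω → Fin n → ℝ))
    (Ψ : (Ω → Fin n → ℝ) → ℝ) : Prop :=
  ∀ d : Fin n → ℝ, (∀ i, d i ≠ 0) → ∀ x ∈ 𝒳, Ψ (mix (Matrix.diagonal d) x) = Ψ x

/-- `Ψ(Λ x) = k(Λ) Ψ(x)` for all `x ∈ 𝒳` and all invertible diagonal `Λ`, with a factor `k(Λ)`
that depends only on `Λ`. -/
def IsRelativelyScaleInvariant {Ω : Type*} {n : ℕ} (𝒳 : Set (Ω → Fin n → ℝ))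
    (Ψ : (Ω → Fin n → ℝ) → ℝ) : Prop :=
  ∃ k : (Fin n → ℝ) → ℝ, ∀ d : Fin n → ℝ, (∀ i, d i ≠ 0) → ∀ x ∈ 𝒳,
    Ψ (mix (Matrix.diagonal d) x) = k d * Ψ x

/-- The sources of linear BSS: independent components of finite variance, at most one of which is
Gaussian. -/
structure IsSource {Ω : Type*} [MeasurableSpace Ω] (P : Measure Ω) {n : ℕ}
    (s : Ω → Fin n → ℝ) : Prop where
  indep : iIndepFun (fun (i : Fin n) (ω : Ω) => s ω i) P
  memLp_two : ∀ i, MemLp (fun ω => s ω i) 2 P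
  gaussian_le_one : ∀ i j, IsGaussian (P.map (fun ω => s ω i)) →
    IsGaussian (P.map (fun ω => s ω j)) → i = j

/-- The sources for which the criterion is defined and finite on all of `ℋ · 𝒮`: every invertible
mixture has differentiable joint and marginal densities and a GFD of finite `Lᵖ` norm. -/
structure IsGFDSource {Ω : Type*} [MeasurableSpace Ω] (P : Measure Ω) {n : ℕ} (p : ℝ)
    (s : Ω → Fin n → ℝ) : Prop extends IsSource P s where
  hasLpGFD : ∀ H ∈ linearFilters n, HasLpGFD p (P.map (mix H s))

end

end BSS

namespace BSS

noncomputable section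

open scoped ENNReal
open Set Filter Topology

/-! The GFD of a law is the gradient of `D`, the product of the marginal densities minus the joint
density. If its norm vanishes, then `D` has zero gradient almost everywhere, hence is constant, and
being integrable over a space of infinite volume it is zero: the components are independent. The
norm of the GFD is therefore a measure of dependence, zero exactly on product laws
(`HasLpGFD.eq_pi_of_gfdIntegral_eq_zero`, `gfd_pi_eq_zero`).

Dominance is then nonnegativity of the norm. Discrimination is the finite-variance Darmois theorem:
if two independent components of `Hs` share a source, that source is Gaussian and they share a
second one, which is Gaussian too (`isGaussian_of_iIndepFun_mixture`). Invariance holds because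
after normalization a trivial filter acts by signs and a permutation, which preserve the norm.

Everything about scaling rests on `HasDiffPDFs.gfdIntegral_monomialMap`: rescaling by `d` multiplies
the `i`-th integral by a common factor times `|d i| ^ (-p)`. Without normalization, doubling one
coordinate thus weights the integrals unequally. A factor depending on the scaling alone would force
all integrals to be equal, then zero, for every mixture, against discrimination.

For regular sources each marginal of `Hs` is a convolution of rescaled densities. Such a convolution
keeps a derivative in `Lᵖ` (`HasLpDerivPDF.conv`), and densities with derivative in `Lᵖ` are
bounded, hence in `Lᵖ`, so both gradients in the GFD are in `Lᵖ`. -/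

/-! ### Differentiable densities under affine maps and products. -/

theorem IsDiffPDF.map_of_inverse {E : Type*} [NormedAddCommGroup E] [NormedSpace ℝ E]
    [MeasureSpace E] [BorelSpace E] {μ : Measure E} {f : E → ℝ} (hf : IsDiffPDF μ f)
    {A B : E → E} (hA : Measurable A) (hB : Differentiable ℝ B)
    (hBA : ∀ x, B (A x) = x) {c : ℝ} (hc : 0 ≤ c)
    (hvol : (volume : Measure E).map A = ENNReal.ofReal c • (volume : Measure E)) :
    IsDiffPDF (μ.map A) (fun y => c * f (B y)) := by
  obtain ⟨hfd, hf0, hμ⟩ := hf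
  refine ⟨(hfd.comp hB).const_mul c, fun x => mul_nonneg hc (hf0 _), ?_⟩
  ext s hs
  have hm : Measurable fun y => ENNReal.ofReal (f (B y)) :=
    (hfd.comp hB).continuous.measurable.ennreal_ofReal
  rw [Measure.map_apply hA hs, hμ, withDensity_apply _ (hA hs), withDensity_apply _ hs]
  have h1 : ∫⁻ a in A ⁻¹' s, ENNReal.ofReal (f a)
      = ∫⁻ y in s, ENNReal.ofReal (f (B y)) ∂((volume : Measure E).map A) := by
    rw [setLIntegral_map hs hm hA]
    simp only [hBA]
  rw [h1, hvol, Measure.restrict_smul, lintegral_smul_measure, smul_eq_mul,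
    ← lintegral_const_mul _ hm]
  simp only [ENNReal.ofReal_mul hc]

theorem map_volume_mulVec_add {n : ℕ} {H : Matrix (Fin n) (Fin n) ℝ} (hH : H.det ≠ 0)
    (b : Fin n → ℝ) :
    (volume : Measure (Fin n → ℝ)).map (fun x => H.mulVec x + b)
      = ENNReal.ofReal |H.det⁻¹| • (volume : Measure (Fin n → ℝ)) := by
  have h1 := Real.map_matrix_volume_pi_eq_smul_volume_pi hH
  have h2 : (fun x => H.mulVec x + b) = (fun y => y + b) ∘ (Matrix.toLin' H) := by
    ext x; simp
  rw [h2, ← Measure.map_map (measurable_add_const b)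
    (Matrix.toLin' H).continuous_of_finiteDimensional.measurable, h1, Measure.map_smul,
    map_add_right_eq_self]

theorem measurable_mulVec_add {n : ℕ} (H : Matrix (Fin n) (Fin n) ℝ) (b : Fin n → ℝ) :
    Measurable (fun x => H.mulVec x + b) := by
  have : Continuous (fun x => H.mulVec x + b) := by fun_prop
  exact this.measurable

theorem measurable_mulVec {n : ℕ} (H : Matrix (Fin n) (Fin n) ℝ) :
    Measurable (fun x => H.mulVec x) := by
  have : Continuous (fun x => H.mulVec x) := by fun_prop
  exact this.measurable

theorem map_volume_mul_add {d : ℝ} (hd : d ≠ 0) (b : ℝ) :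
    (volume : Measure ℝ).map (fun x => d * x + b)
      = ENNReal.ofReal |d⁻¹| • (volume : Measure ℝ) := by
  have h2 : (fun x => d * x + b) = (fun y => y + b) ∘ (fun x => d * x) := rfl
  rw [h2, ← Measure.map_map (measurable_add_const b) (measurable_const_mul d),
    Real.map_volume_mul_left hd, Measure.map_smul, map_add_right_eq_self]

theorem IsDiffPDF.map_mul_add {μ : Measure ℝ} {f : ℝ → ℝ} (hf : IsDiffPDF μ f) {d : ℝ}
    (hd : d ≠ 0) (b : ℝ) :
    IsDiffPDF (μ.map (fun x => d * x + b)) (fun y => |d⁻¹| * f (d⁻¹ * (y - b))) :=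
  hf.map_of_inverse (B := fun y => d⁻¹ * (y - b)) (by fun_prop) (by fun_prop)
    (fun x => by field_simp; ring) (abs_nonneg _) (map_volume_mul_add hd b)

theorem IsDiffPDF.integrable {E : Type*} [NormedAddCommGroup E] [NormedSpace ℝ E]
    [MeasureSpace E] [BorelSpace E] {μ : Measure E} [IsProbabilityMeasure μ] {f : E → ℝ}
    (hf : IsDiffPDF μ f) : Integrable f := by
  obtain ⟨hfd, hf0, hμ⟩ := hf
  have h : ∫⁻ x, ENNReal.ofReal (f x) = 1 := by
    rw [← setLIntegral_univ, ← withDensity_apply _ MeasurableSet.univ, ← hμ, measure_univ]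
  exact (lintegral_ofReal_ne_top_iff_integrable
    hfd.continuous.aestronglyMeasurable (ae_of_all _ hf0)).1 (by rw [h]; simp)

theorem IsDiffPDF.integral_eq_one {E : Type*} [NormedAddCommGroup E] [NormedSpace ℝ E]
    [MeasureSpace E] [BorelSpace E] {μ : Measure E} [IsProbabilityMeasure μ] {f : E → ℝ}
    (hf : IsDiffPDF μ f) : ∫ x, f x = 1 := by
  obtain ⟨hfd, hf0, hμ⟩ := hf
  have h : ∫⁻ x, ENNReal.ofReal (f x) = 1 := by
    rw [← setLIntegral_univ, ← withDensity_apply _ MeasurableSet.univ, ← hμ, measure_univ]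
  rw [integral_eq_lintegral_of_nonneg_ae (ae_of_all _ hf0)
    hfd.continuous.aestronglyMeasurable, h]
  simp

theorem hasFDerivAt_prod_apply {n : ℕ} {f : Fin n → ℝ → ℝ} (hf : ∀ i, Differentiable ℝ (f i))
    (x : Fin n → ℝ) :
    HasFDerivAt (fun x : Fin n → ℝ => ∏ i, f i (x i))
      (∑ i, (∏ j ∈ Finset.univ.erase i, f j (x j)) •
        (deriv (f i) (x i) • ContinuousLinearMap.proj (R := ℝ) (φ := fun _ : Fin n => ℝ) i)) x :=
  HasFDerivAt.finsetProd (g := fun i (x : Fin n → ℝ) => f i (x i)) fun i _ =>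
    ((hf i) (x i)).hasDerivAt.comp_hasFDerivAt (f := fun x : Fin n → ℝ => x i) x
      (hasFDerivAt_apply i x)

/-- The partial derivative is kept as a single product of one-variable functions, so that its `Lᵖ`
norm factors by Fubini. -/
theorem fderiv_prod_apply_single {n : ℕ} {f : Fin n → ℝ → ℝ} (hf : ∀ i, Differentiable ℝ (f i))
    (x : Fin n → ℝ) (i : Fin n) :
    fderiv ℝ (fun x : Fin n → ℝ => ∏ i, f i (x i)) x (Pi.single i 1)
      = ∏ j, (if j = i then deriv (f i) (x j) else f j (x j)) := by
  rw [(hasFDerivAt_prod_apply hf x).fderiv, sum_apply,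
    Finset.sum_eq_single i, ← Finset.mul_prod_erase _ _ (Finset.mem_univ i)]
  · simp only [smul_apply, ContinuousLinearMap.proj_apply, Pi.single_eq_same,
      smul_eq_mul, mul_one, if_true]
    rw [mul_comm]
    congr 1
    exact Finset.prod_congr rfl fun j hj => by rw [if_neg (Finset.ne_of_mem_erase hj)]
  · intro j _ hj
    simp [hj]
  · simp

theorem IsDiffPDF.pi {n : ℕ} {m : Fin n → Measure ℝ} [∀ i, IsProbabilityMeasure (m i)]
    {f : Fin n → ℝ → ℝ} (hf : ∀ i, IsDiffPDF (m i) (f i)) :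
    IsDiffPDF (Measure.pi m) (fun x => ∏ i, f i (x i)) := by
  have hd : Differentiable ℝ fun x : Fin n → ℝ => ∏ i, f i (x i) := fun x =>
    (hasFDerivAt_prod_apply (fun i => (hf i).1) x).differentiableAt
  have h0 (x : Fin n → ℝ) : 0 ≤ ∏ i, f i (x i) := Finset.prod_nonneg fun i _ => (hf i).2.1 _
  refine ⟨hd, h0, ?_⟩
  refine Measure.pi_eq fun s hs => ?_
  rw [withDensity_apply _ (MeasurableSet.univ_pi hs), volume_pi, Measure.restrict_pi_pi,
    ← ofReal_integral_eq_lintegral_ofReal, integral_fintype_prod_eq_prod,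
    ENNReal.ofReal_prod_of_nonneg]
  · refine Finset.prod_congr rfl fun i _ => ?_
    rw [(hf i).2.2, withDensity_apply _ (hs i), ofReal_integral_eq_lintegral_ofReal
      ((hf i).integrable.restrict) (ae_of_all _ (hf i).2.1)]
  · exact fun i _ => integral_nonneg (hf i).2.1
  · exact Integrable.fintype_prod fun i => (hf i).integrable.restrict
  · exact ae_of_all _ h0

theorem IsDiffPDF.map_mulVec_add {n : ℕ} {μ : Measure (Fin n → ℝ)} {f : (Fin n → ℝ) → ℝ}
    (hf : IsDiffPDF μ f) {H : Matrix (Fin n) (Fin n) ℝ} (hH : H.det ≠ 0) (b : Fin n → ℝ) :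
    IsDiffPDF (μ.map (fun x => H.mulVec x + b))
      (fun y => |H.det⁻¹| * f (H⁻¹.mulVec (y - b))) := by
  refine hf.map_of_inverse (B := fun y => H⁻¹.mulVec (y - b)) (measurable_mulVec_add H b)
    ?_ (fun x => ?_) (abs_nonneg _) (map_volume_mulVec_add hH b)
  · exact ((Matrix.mulVecLin H⁻¹).toContinuousLinearMap.differentiable).comp
      (differentiable_id.sub_const b)
  · simp [Matrix.nonsing_inv_mul _ (isUnit_iff_ne_zero.2 hH)]

theorem marginal_map {n : ℕ} (μ : Measure (Fin n → ℝ)) {A : (Fin n → ℝ) → Fin n → ℝ}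
    (hA : Measurable A) (i : Fin n) : marginal (μ.map A) i = μ.map fun x => A x i :=
  Measure.map_map (measurable_pi_apply i) hA

instance {n : ℕ} (μ : Measure (Fin n → ℝ)) [IsProbabilityMeasure μ] (i : Fin n) :
    IsProbabilityMeasure (marginal μ i) :=
  Measure.isProbabilityMeasure_map (measurable_pi_apply i).aemeasurable

/-! ### Convolution of densities with derivative in `Lᵖ`. -/

theorem intervalIntegrable_of_memLp {F : ℝ → ℝ} {p : ℝ≥0∞} (hp : 1 ≤ p) (hF : MemLp F p) (a b : ℝ) :
    IntervalIntegrable F volume a b := by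
  rw [intervalIntegrable_iff]
  have : IsFiniteMeasure ((volume : Measure ℝ).restrict (Set.uIoc a b)) :=
    ⟨by simp [Set.uIoc]⟩
  exact (hF.restrict (Set.uIoc a b)).integrable hp

/-- A differentiable density with derivative in `Lᵖ` is bounded. -/
theorem IsDiffPDF.bounded_of_memLp_deriv {μ : Measure ℝ} [IsProbabilityMeasure μ] {f : ℝ → ℝ}
    (hf : IsDiffPDF μ f) {p : ℝ≥0∞} (hp : 1 ≤ p) (hf' : MemLp (deriv f) p) :
    ∃ M : ℝ, ∀ x, f x ≤ M := by
  set C := (eLpNorm (deriv f) p volume).toReal with hC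
  -- On a unit interval the `L¹` norm of `f'` is at most its `Lᵖ` norm, so `f x ≤ f y + C` for `y`
  -- in `(x, x + 1]`. Averaging over `y` and using `∫ f = 1` gives the bound.
  refine ⟨1 + C, fun x => ?_⟩
  have hint := intervalIntegrable_of_memLp hp hf'
  have hprob : IsProbabilityMeasure ((volume : Measure ℝ).restrict (Ioc x (x + 1))) :=
    ⟨by simp⟩
  have hnorm : ∫ t in Ioc x (x + 1), |deriv f t| ≤ C := by
    have h1 : ∫ t in Ioc x (x + 1), |deriv f t|
        = (eLpNorm (deriv f) 1 (volume.restrict (Ioc x (x + 1)))).toReal := by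
      rw [eLpNorm_one_eq_lintegral_enorm]
      exact integral_norm_eq_lintegral_enorm hf'.1.restrict
    rw [h1, hC]
    refine ENNReal.toReal_mono hf'.2.ne ?_
    exact (eLpNorm_le_eLpNorm_of_exponent_le hp hf'.1.restrict).trans
      (eLpNorm_mono_measure _ Measure.restrict_le_self)
  have hle : ∀ y ∈ Ioc x (x + 1), f x ≤ f y + C := by
    intro y hy
    have h1 : ∫ t in x..y, deriv f t = f y - f x :=
      intervalIntegral.integral_eq_sub_of_hasDerivAt
        (fun t _ => (hf.1 t).hasDerivAt) (hint x y)
    have h2 : ‖∫ t in x..y, deriv f t‖ ≤ ∫ t in Ioc x (x + 1), |deriv f t| := by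
      rw [intervalIntegral.integral_of_le hy.1.le]
      refine (norm_integral_le_integral_norm _).trans ?_
      refine setIntegral_mono_set ?_ (ae_of_all _ fun t => abs_nonneg _)
        (LE.le.eventuallyLE (Ioc_subset_Ioc_right hy.2))
      exact ((hf'.restrict _).integrable hp).norm
    rw [h1, Real.norm_eq_abs, abs_sub_comm] at h2
    linarith [le_abs_self (f x - f y)]
  have h3 : ∫ _ in Ioc x (x + 1), f x ≤ ∫ y in Ioc x (x + 1), (f y + C) :=
    setIntegral_mono_on (integrable_const _)
      ((hf.integrable.restrict).add (integrable_const _)) measurableSet_Ioc hle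
  rw [integral_add hf.integrable.restrict (integrable_const _)] at h3
  simp only [integral_const, probReal_univ, one_smul] at h3
  have h4 : ∫ y in Ioc x (x + 1), f y ≤ 1 := by
    rw [← hf.integral_eq_one]
    exact setIntegral_le_integral hf.integrable (ae_of_all _ hf.2.1)
  linarith

theorem IsDiffPDF.le_smul_volume {μ : Measure ℝ} {f : ℝ → ℝ} (hf : IsDiffPDF μ f) {M : ℝ}
    (hM : ∀ x, f x ≤ M) : μ ≤ ENNReal.ofReal M • (volume : Measure ℝ) := by
  rw [hf.2.2, ← withDensity_const]
  exact withDensity_mono (ae_of_all _ fun x => ENNReal.ofReal_le_ofReal (hM x))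

theorem measurePreserving_sub (ν : Measure ℝ) [IsProbabilityMeasure ν] :
    MeasurePreserving (fun z : ℝ × ℝ => z.1 - z.2) ((volume : Measure ℝ).prod ν) volume :=
  measurePreserving_fst.comp (measurePreserving_sub_prod volume ν)

/-- Averaging over a probability measure contracts `Lᵖ` norms: for fixed `x`, the `L¹` norm in `t`
is at most the `Lᵖ` norm, and Tonelli finishes. -/
theorem MemLp.integral_right {α β : Type*} [MeasurableSpace α] [MeasurableSpace β]
    {μ : Measure α} [SFinite μ] {ν : Measure β} [IsProbabilityMeasure ν]
    {p : ℝ≥0∞} (hp : 1 ≤ p) (hp' : p ≠ ∞) {G : α × β → ℝ} (hGm : Measurable G)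
    (hG : MemLp G p (μ.prod ν)) : MemLp (fun x => ∫ t, G (x, t) ∂ν) p μ := by
  have hp0 : p ≠ 0 := (zero_lt_one.trans_le hp).ne'
  refine ⟨hGm.stronglyMeasurable.integral_prod_right'.aestronglyMeasurable, ?_⟩
  have hfin := hG.2
  rw [eLpNorm_lt_top_iff_lintegral_rpow_enorm_lt_top hp0 hp'] at hfin ⊢
  rw [lintegral_prod _ (by fun_prop)] at hfin
  refine lt_of_le_of_lt (lintegral_mono fun x => ?_) hfin
  have hpr : 0 < p.toReal := ENNReal.toReal_pos hp0 hp'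
  have hsl : AEStronglyMeasurable (fun t => G (x, t)) ν :=
    (hGm.comp measurable_prodMk_left).aestronglyMeasurable
  have h1 : ‖∫ t, G (x, t) ∂ν‖ₑ ≤ eLpNorm (fun t => G (x, t)) p ν := by
    refine (enorm_integral_le_lintegral_enorm _).trans ?_
    rw [← eLpNorm_one_eq_lintegral_enorm]
    exact eLpNorm_le_eLpNorm_of_exponent_le hp hsl
  calc ‖∫ t, G (x, t) ∂ν‖ₑ ^ p.toReal
      ≤ (eLpNorm (fun t => G (x, t)) p ν) ^ p.toReal := ENNReal.rpow_le_rpow h1 hpr.le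
    _ = ∫⁻ t, ‖G (x, t)‖ₑ ^ p.toReal ∂ν := by
      rw [eLpNorm_eq_lintegral_rpow_enorm_toReal hp0 hp', ← ENNReal.rpow_mul,
        one_div_mul_cancel hpr.ne', ENNReal.rpow_one]

/-- Translation is continuous in `Lᵖ` for finite `p`, and domination of `ν` by a multiple of
Lebesgue measure transfers this to `Lᵖ(ν)`, hence to the integrals. -/
theorem continuous_integral_sub_of_memLp {ν : Measure ℝ} [IsProbabilityMeasure ν] {C : ℝ≥0∞}
    (hC : C ≠ ∞) (hν : ν ≤ C • (volume : Measure ℝ)) {p : ℝ≥0∞} (hp : 1 ≤ p) (hp' : p ≠ ∞)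
    {F : ℝ → ℝ} (hF : MemLp F p) :
    Continuous fun x => ∫ t, F (x - t) ∂ν := by
  have : Fact (1 ≤ p) := ⟨hp⟩
  have hpres (x : ℝ) : MeasurePreserving (fun t => x - t) (volume : Measure ℝ) volume :=
    Measure.measurePreserving_sub_left volume x
  have hslice (x : ℝ) : MemLp (fun t => F (x - t)) p volume := hF.comp_measurePreserving (hpres x)
  have hsliceν (x : ℝ) : MemLp (fun t => F (x - t)) p ν := (hslice x).of_measure_le_smul hC hν
  let g : C(ℝ, C(ℝ, ℝ)) := ContinuousMap.curry ⟨fun z : ℝ × ℝ => z.1 - z.2, by fun_prop⟩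
  have hT : Continuous fun x : ℝ =>
      Lp.compMeasurePreserving (fun t => x - t) (hpres x) (hF.toLp F) :=
    (continuous_const (y := hF.toLp F)).compMeasurePreservingLp (g := g) g.continuous hpres hp'
  rw [continuous_iff_continuousAt]
  intro x
  rw [ContinuousAt, tendsto_iff_edist_tendsto_0]
  have h1 := tendsto_iff_edist_tendsto_0.1 (hT.tendsto x)
  have h2 := ENNReal.Tendsto.const_mul (a := C ^ (1 / p).toReal) h1
    (Or.inr (ENNReal.rpow_ne_top_of_nonneg ENNReal.toReal_nonneg hC))
  rw [mul_zero] at h2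
  refine tendsto_of_tendsto_of_tendsto_of_le_of_le tendsto_const_nhds h2 (fun _ => zero_le) ?_
  intro y
  have hT' (x : ℝ) : Lp.compMeasurePreserving (fun t => x - t) (hpres x) (hF.toLp F)
      = (hslice x).toLp _ := Lp.toLp_compMeasurePreserving hF (hpres x)
  simp only [hT', Lp.edist_toLp_toLp]
  rw [edist_eq_enorm_sub,
    ← integral_sub ((hsliceν y).integrable hp) ((hsliceν x).integrable hp)]
  refine (enorm_integral_le_lintegral_enorm _).trans ?_
  rw [← eLpNorm_one_eq_lintegral_enorm]
  refine (eLpNorm_le_eLpNorm_of_exponent_le hp ((hsliceν y).1.sub (hsliceν x).1)).trans ?_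
  refine (eLpNorm_mono_measure _ hν).trans ?_
  rw [eLpNorm_smul_measure_of_ne_top hp', smul_eq_mul]

/-- With `f'` only in `Lᵖ` there need be no dominating function for differentiating under the
integral. Instead Fubini and the fundamental theorem of calculus express the convolution as a
primitive of the convolved derivative, which is continuous. -/
theorem hasDerivAt_integral_sub {ν : Measure ℝ} [IsProbabilityMeasure ν] {C : ℝ≥0∞}
    (hC : C ≠ ∞) (hν : ν ≤ C • (volume : Measure ℝ)) {p : ℝ≥0∞} (hp : 1 ≤ p) (hp' : p ≠ ∞)
    {f : ℝ → ℝ} (hf : Differentiable ℝ f) (hfν : ∀ x, Integrable (fun t => f (x - t)) ν)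
    (hF : MemLp (deriv f) p) (x : ℝ) :
    HasDerivAt (fun x => ∫ t, f (x - t) ∂ν) (∫ t, deriv f (x - t) ∂ν) x := by
  have hk := continuous_integral_sub_of_memLp hC hν hp hp' hF
  have hG : MemLp (fun z : ℝ × ℝ => deriv f (z.1 - z.2)) p ((volume : Measure ℝ).prod ν) :=
    hF.comp_measurePreserving (measurePreserving_sub ν)
  have hslice (t : ℝ) : MemLp (fun x => deriv f (x - t)) p volume :=
    hF.comp_measurePreserving (measurePreserving_sub_right volume t)
  have hftc : ∀ a b : ℝ, a ≤ b → ∫ x in a..b, ∫ t, deriv f (x - t) ∂ν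
      = (∫ t, f (b - t) ∂ν) - ∫ t, f (a - t) ∂ν := by
    intro a b hab
    rw [intervalIntegral.integral_of_le hab, integral_integral_swap, ← integral_sub (hfν b) (hfν a)]
    · refine integral_congr_ae (ae_of_all _ fun t => ?_)
      simp only
      rw [← intervalIntegral.integral_of_le hab]
      refine intervalIntegral.integral_eq_sub_of_hasDerivAt (f := fun x => f (x - t))
        (fun s _ => ?_) (intervalIntegrable_of_memLp hp (hslice t) a b)
      exact (hf (s - t)).hasDerivAt.comp_sub_const s t
    · have h1 : MemLp (fun z : ℝ × ℝ => deriv f (z.1 - z.2)) p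
          ((volume.restrict (Ioc a b)).prod ν) := by
        refine hG.mono_measure ?_
        rw [← Measure.restrict_univ (μ := ν), Measure.prod_restrict]
        refine Measure.restrict_le_self.trans ?_
        simp
      exact h1.integrable hp
  have h2 : (fun y => ∫ t, f (y - t) ∂ν)
      = fun y => (∫ t, f (x - 1 - t) ∂ν) + ∫ s in (x - 1)..y, ∫ t, deriv f (s - t) ∂ν := by
    funext y
    rcases le_total (x - 1) y with h | h
    · rw [hftc _ _ h]; ring
    · rw [intervalIntegral.integral_symm, hftc _ _ h]; ring
  rw [h2]
  exact (intervalIntegral.integral_hasDerivAt_right (hk.intervalIntegrable _ _)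
    hk.aestronglyMeasurable.stronglyMeasurableAtFilter hk.continuousAt).const_add _

/-- The laws on `ℝ` with a differentiable density whose derivative lies in `Lᵖ`. -/
def HasLpDerivPDF (p : ℝ≥0∞) (μ : Measure ℝ) : Prop :=
  ∃ f : ℝ → ℝ, IsDiffPDF μ f ∧ MemLp (deriv f) p volume

theorem HasLpDerivPDF.conv {p : ℝ≥0∞} (hp : 1 ≤ p) (hp' : p ≠ ∞) {μ ν : Measure ℝ}
    [IsProbabilityMeasure μ] [IsProbabilityMeasure ν] (hμ : HasLpDerivPDF p μ)
    (hν : HasLpDerivPDF p ν) : HasLpDerivPDF p (μ.conv ν) := by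
  obtain ⟨f, hf, hf'⟩ := hμ
  obtain ⟨g, hg, hg'⟩ := hν
  obtain ⟨M, hM⟩ := hg.bounded_of_memLp_deriv hp hg'
  obtain ⟨N, hN⟩ := hf.bounded_of_memLp_deriv hp hf'
  have hνM := hg.le_smul_volume hM
  have hfm : Measurable f := hf.1.continuous.measurable
  have hfν (x : ℝ) : Integrable (fun t => f (x - t)) ν := by
    refine Integrable.of_bound (C := N)
      (hfm.comp (measurable_const_sub x)).aestronglyMeasurable (ae_of_all _ fun t => ?_)
    rw [Real.norm_of_nonneg (hf.2.1 _)]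
    exact hN _
  have hd (x : ℝ) := hasDerivAt_integral_sub ENNReal.ofReal_ne_top hνM hp hp' hf.1 hfν hf' x
  refine ⟨fun x => ∫ t, f (x - t) ∂ν, ⟨fun x => (hd x).differentiableAt,
    fun x => integral_nonneg fun t => hf.2.1 _, ?_⟩, ?_⟩
  · ext s hs
    rw [withDensity_apply _ hs, ← lintegral_indicator_one hs,
      Measure.lintegral_conv (measurable_one.indicator hs)]
    have h1 (x : ℝ) : ENNReal.ofReal (∫ t, f (x - t) ∂ν) = ∫⁻ t, ENNReal.ofReal (f (x - t)) ∂ν :=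
      ofReal_integral_eq_lintegral_ofReal (hfν x) (ae_of_all _ fun t => hf.2.1 _)
    simp only [h1]
    have hm1 : AEMeasurable (Function.uncurry fun a t : ℝ => ENNReal.ofReal (f (a - t)))
        ((volume.restrict s).prod ν) := by
      have : Measurable fun z : ℝ × ℝ => ENNReal.ofReal (f (z.1 - z.2)) := by fun_prop
      exact this.aemeasurable
    have hm2 : AEMeasurable (Function.uncurry fun x t : ℝ => s.indicator (1 : ℝ → ℝ≥0∞) (x + t))
        (μ.prod ν) :=
      ((measurable_one.indicator hs).comp (measurable_fst.add measurable_snd)).aemeasurable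
    rw [lintegral_lintegral_swap hm1, lintegral_lintegral_swap hm2]
    refine lintegral_congr fun t => ?_
    rw [hf.2.2, lintegral_withDensity_eq_lintegral_mul _ (by fun_prop)]
    · rw [← lintegral_indicator hs,
        ← lintegral_add_right_eq_self (fun x => s.indicator
          (fun a => ENNReal.ofReal (f (a - t))) x) t]
      refine lintegral_congr fun x => ?_
      by_cases hx : x + t ∈ s <;> simp [hx]
    · exact (measurable_one.indicator hs).comp (measurable_add_const t)
  · have h1 : deriv (fun x => ∫ t, f (x - t) ∂ν) = fun x => ∫ t, deriv f (x - t) ∂ν :=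
      funext fun x => (hd x).deriv
    rw [h1]
    have hdm := measurable_deriv f
    exact MemLp.integral_right (G := fun z : ℝ × ℝ => deriv f (z.1 - z.2)) hp hp'
      (by fun_prop) (hf'.comp_measurePreserving (measurePreserving_sub ν))

theorem HasLpDerivPDF.map_mul {p : ℝ≥0∞} {μ : Measure ℝ} (hμ : HasLpDerivPDF p μ) {d : ℝ}
    (hd : d ≠ 0) : HasLpDerivPDF p (μ.map fun x => d * x) := by
  obtain ⟨f, hf, hf'⟩ := hμ
  have h := hf.map_mul_add hd 0
  simp only [add_zero, sub_zero] at h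
  refine ⟨_, h, ?_⟩
  have h1 : deriv (fun y => |d⁻¹| * f (d⁻¹ * y))
      = fun y => |d⁻¹| * (d⁻¹ * deriv f (d⁻¹ * y)) := by
    funext y
    have h2 : HasDerivAt (fun y => f (d⁻¹ * y)) (deriv f (d⁻¹ * y) * (d⁻¹ * 1)) y :=
      (hf.1 _).hasDerivAt.comp y ((hasDerivAt_id y).const_mul d⁻¹)
    rw [(h2.const_mul _).deriv]
    ring
  rw [h1]
  refine MemLp.const_mul (MemLp.const_mul ?_ _) _
  have h3 : MemLp (deriv f) p ((volume : Measure ℝ).map fun y => d⁻¹ * y) := by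
    rw [Real.map_volume_mul_left (inv_ne_zero hd)]
    exact hf'.smul_measure ENNReal.ofReal_ne_top
  exact h3.comp_of_map (measurable_const_mul _).aemeasurable

theorem HasLpDerivPDF.map_sum {p : ℝ≥0∞} (hp : 1 ≤ p) (hp' : p ≠ ∞) {ι Ω : Type*}
    [MeasurableSpace Ω] {P : Measure Ω} [IsProbabilityMeasure P] {X : ι → Ω → ℝ}
    (hX : iIndepFun X P) (hXm : ∀ i, Measurable (X i)) {S : Finset ι} (hS : S.Nonempty)
    (hD : ∀ i ∈ S, HasLpDerivPDF p (P.map (X i))) :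
    HasLpDerivPDF p (P.map (∑ i ∈ S, X i)) := by
  induction hS using Finset.Nonempty.cons_induction with
  | singleton a => simpa using hD a
  | cons a S ha hS ih =>
    rw [Finset.sum_cons, (hX.indepFun_finsetSum_of_notMem hXm ha).symm.map_add_eq_map_conv_map
      (hXm a) (by fun_prop)]
    have := Measure.isProbabilityMeasure_map (μ := P) (hXm a).aemeasurable
    have hm : Measurable (∑ i ∈ S, X i) := by fun_prop
    have := Measure.isProbabilityMeasure_map (μ := P) hm.aemeasurable
    exact (hD a (by simp)).conv hp hp' (ih fun i hi => hD i (by simp [hi]))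

/-! ### Finiteness of the criterion on mixtures of regular sources. -/

theorem memLp_ofReal_iff {α : Type*} [MeasurableSpace α] {μ : Measure α} {p : ℝ} (hp : 1 ≤ p)
    {g : α → ℝ} (hg : AEStronglyMeasurable g μ) :
    MemLp g (ENNReal.ofReal p) μ ↔ Integrable (fun x => |g x| ^ p) μ := by
  rw [← integrable_norm_rpow_iff hg (by simp; linarith) ENNReal.ofReal_ne_top,
    ENNReal.toReal_ofReal (by linarith)]
  simp only [Real.norm_eq_abs]

/-- Interpolation between `L¹` and `L^∞`: `g ^ p ≤ M ^ (p - 1) * g`. -/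
theorem memLp_of_integrable_of_le {α : Type*} [MeasurableSpace α] {μ : Measure α} {p : ℝ}
    (hp : 1 ≤ p) {g : α → ℝ} (hg : Integrable g μ) (hg0 : ∀ x, 0 ≤ g x) {M : ℝ}
    (hM : ∀ x, g x ≤ M) : MemLp g (ENNReal.ofReal p) μ := by
  rw [memLp_ofReal_iff hp hg.1]
  refine (hg.const_mul (M ^ (p - 1))).mono'
    ((hg.1.norm.aemeasurable.pow_const p).aestronglyMeasurable) (ae_of_all _ fun x => ?_)
  have h1 : |g x| ^ p = g x ^ (p - 1) * g x := by
    rw [abs_of_nonneg (hg0 x)]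
    conv_lhs => rw [show p = (p - 1) + 1 by ring,
      Real.rpow_add_of_nonneg (hg0 x) (by linarith) zero_le_one, Real.rpow_one]
  rw [Real.norm_of_nonneg (by positivity), h1]
  exact mul_le_mul_of_nonneg_right (Real.rpow_le_rpow (hg0 x) (hM x) (by linarith)) (hg0 x)

theorem MemLp.fintype_prod {n : ℕ} {p : ℝ} (hp : 1 ≤ p) {g : Fin n → ℝ → ℝ}
    (hg : ∀ i, MemLp (g i) (ENNReal.ofReal p) volume) (hgm : ∀ i, Measurable (g i)) :
    MemLp (fun x : Fin n → ℝ => ∏ i, g i (x i)) (ENNReal.ofReal p) volume := by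
  have hm : Measurable (fun x : Fin n → ℝ => ∏ i, g i (x i)) := by fun_prop
  rw [memLp_ofReal_iff hp hm.aestronglyMeasurable]
  have h (x : Fin n → ℝ) : |∏ i, g i (x i)| ^ p = ∏ i, |g i (x i)| ^ p := by
    rw [Finset.abs_prod, Real.finsetProd_rpow _ _ fun i _ => abs_nonneg _]
  simp only [h]
  exact Integrable.fintype_prod (f := fun i x => |g i x| ^ p) fun i =>
    (memLp_ofReal_iff hp (hgm i).aestronglyMeasurable).1 (hg i)

/-- The partial derivatives of a product density with factors whose derivatives are in `Lᵖ`. -/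
theorem memLp_fderiv_prod {n : ℕ} {p : ℝ} (hp : 1 ≤ p) {m : Fin n → Measure ℝ}
    [∀ i, IsProbabilityMeasure (m i)] {f : Fin n → ℝ → ℝ} (hf : ∀ i, IsDiffPDF (m i) (f i))
    (hf' : ∀ i, MemLp (deriv (f i)) (ENNReal.ofReal p) volume) (i : Fin n) :
    MemLp (fun x => fderiv ℝ (fun x : Fin n → ℝ => ∏ i, f i (x i)) x (Pi.single i 1))
      (ENNReal.ofReal p) volume := by
  simp only [fderiv_prod_apply_single fun i => (hf i).1]
  have hp1 : (1 : ℝ≥0∞) ≤ ENNReal.ofReal p := by simpa using hp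
  refine MemLp.fintype_prod hp (g := fun j x => if j = i then deriv (f i) x else f j x)
    (fun j => ?_) fun j => ?_
  · by_cases h : j = i
    · simpa [h] using hf' i
    · obtain ⟨M, hM⟩ := (hf j).bounded_of_memLp_deriv hp1 (hf' j)
      simpa [h] using memLp_of_integrable_of_le hp (hf j).integrable (hf j).2.1 hM
  · by_cases h : j = i
    · simpa [h] using measurable_deriv (f i)
    · simpa [h] using (hf j).1.continuous.measurable

theorem MemLp.comp_mulVec {n : ℕ} {p : ℝ≥0∞} {H : Matrix (Fin n) (Fin n) ℝ}
    (hH : H.det ≠ 0) {g : (Fin n → ℝ) → ℝ} (hg : MemLp g p volume) :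
    MemLp (fun x => g (H.mulVec x)) p volume := by
  have h1 := map_volume_mulVec_add hH 0
  simp only [add_zero] at h1
  have h3 : MemLp g p ((volume : Measure (Fin n → ℝ)).map fun y => H.mulVec y) := by
    rw [h1]
    exact hg.smul_measure ENNReal.ofReal_ne_top
  exact h3.comp_of_map (measurable_mulVec H).aemeasurable

theorem marginal_pi {n : ℕ} (m : Fin n → Measure ℝ) [∀ i, IsProbabilityMeasure (m i)]
    (i : Fin n) : marginal (Measure.pi m) i = m i :=
  (measurePreserving_eval m i).map_eq

theorem iIndepFun_apply_pi {n : ℕ} (m : Fin n → Measure ℝ) [∀ i, IsProbabilityMeasure (m i)] :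
    iIndepFun (fun (i : Fin n) (x : Fin n → ℝ) => x i) (Measure.pi m) :=
  iIndepFun_pi (X := fun _ x => x) fun _ => aemeasurable_id

theorem HasLpDerivPDF.marginal_mulVec {n : ℕ} {p : ℝ≥0∞} (hp : 1 ≤ p) (hp' : p ≠ ∞)
    {m : Fin n → Measure ℝ} [∀ i, IsProbabilityMeasure (m i)]
    (hm : ∀ i, HasLpDerivPDF p (m i)) {H : Matrix (Fin n) (Fin n) ℝ} (hH : H.det ≠ 0)
    (i : Fin n) : HasLpDerivPDF p (marginal ((Measure.pi m).map H.mulVec) i) := by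
  classical
  rw [marginal_map _ (measurable_mulVec H)]
  -- Zero coefficients are discarded because the law of `0 * x j` is a point mass, without density.
  -- Some coefficient survives since `H` has no zero row.
  have hS : (Finset.univ.filter fun j => H i j ≠ 0).Nonempty := by
    by_contra h
    rw [Finset.not_nonempty_iff_eq_empty, Finset.filter_eq_empty_iff] at h
    exact hH (Matrix.det_eq_zero_of_row_eq_zero i fun j => by simpa using h (Finset.mem_univ j))
  have hX := (iIndepFun_apply_pi m).comp (fun j x => H i j * x) fun j => measurable_const_mul _
  have hsum : (fun x : Fin n → ℝ => H.mulVec x i)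
      = ∑ j ∈ Finset.univ.filter (fun j => H i j ≠ 0), fun x : Fin n → ℝ => H i j * x j := by
    funext x
    rw [Finset.sum_apply, Finset.sum_filter]
    change ∑ j, H i j * x j = _
    refine Finset.sum_congr rfl fun j _ => ?_
    by_cases h : H i j = 0 <;> simp [h]
  rw [hsum]
  refine HasLpDerivPDF.map_sum hp hp' hX (fun j => by fun_prop) hS fun j hj => ?_
  have h1 : (Measure.pi m).map (fun x => H i j * x j) = (m j).map fun x => H i j * x := by
    conv_rhs => rw [← marginal_pi m j]
    exact (Measure.map_map (measurable_const_mul (H i j)) (measurable_pi_apply j)).symm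
  rw [show ((fun x => H i j * x) ∘ fun x : Fin n → ℝ => x j) = fun x => H i j * x j from rfl, h1]
  exact (hm j).map_mul (Finset.mem_filter.1 hj).2

/-- The two gradients are in `Lᵖ` separately. By the chain rule the joint one is a linear
combination of partial derivatives of the source density, composed with `H⁻¹`. -/
theorem hasLpGFD_map_mulVec_pi {n : ℕ} {p : ℝ} (hp : 1 ≤ p) {m : Fin n → Measure ℝ}
    [∀ i, IsProbabilityMeasure (m i)] (hm : ∀ i, HasLpDerivPDF (ENNReal.ofReal p) (m i))
    {H : Matrix (Fin n) (Fin n) ℝ} (hH : H.det ≠ 0) :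
    HasLpGFD p ((Measure.pi m).map H.mulVec) := by
  have hp1 : (1 : ℝ≥0∞) ≤ ENNReal.ofReal p := by simpa using hp
  have hmarg := HasLpDerivPDF.marginal_mulVec hp1 ENNReal.ofReal_ne_top hm hH
  choose f hf hf' using hm
  choose g hg hg' using hmarg
  have hprob : IsProbabilityMeasure ((Measure.pi m).map H.mulVec) :=
    Measure.isProbabilityMeasure_map (measurable_mulVec H).aemeasurable
  have hjoint := (IsDiffPDF.pi hf).map_mulVec_add hH 0
  simp only [add_zero, sub_zero] at hjoint
  refine ⟨⟨_, hjoint⟩, fun i => ⟨g i, hg i⟩, fun i => MemLp.sub ?_ ?_⟩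
  · have h1 : prodPDF ((Measure.pi m).map H.mulVec) = fun x => ∏ i, g i (x i) := by
      funext x
      simp only [prodPDF, diffPDF_eq (hg _)]
    unfold gpf
    rw [h1]
    exact memLp_fderiv_prod hp hg hg' i
  · have h1 : jointPDF ((Measure.pi m).map H.mulVec)
        = fun y => |H.det⁻¹| * ∏ j, f j (H⁻¹.mulVec y j) := by
      funext x
      rw [jointPDF, diffPDF_eq hjoint]
    have hHi : H⁻¹.det ≠ 0 := by simpa [Matrix.det_nonsing_inv] using hH
    have h2 (y : Fin n → ℝ) : gjf ((Measure.pi m).map H.mulVec) i y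
        = |H.det⁻¹| * ∑ k, H⁻¹ k i *
          fderiv ℝ (fun x : Fin n → ℝ => ∏ i, f i (x i)) (H⁻¹.mulVec y) (Pi.single k 1) := by
      have hL : HasFDerivAt (fun y => H⁻¹.mulVec y)
          (Matrix.mulVecLin H⁻¹).toContinuousLinearMap y :=
        (Matrix.mulVecLin H⁻¹).toContinuousLinearMap.hasFDerivAt
      have hF := (IsDiffPDF.pi hf).1 (H⁻¹.mulVec y)
      have h3 : HasFDerivAt (fun y => |H.det⁻¹| * ∏ j, f j (H⁻¹.mulVec y j)) _ y :=
        (hF.hasFDerivAt.comp y hL).const_mul |H.det⁻¹|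
      rw [gjf, h1, h3.fderiv]
      simp only [smul_apply, ContinuousLinearMap.comp_apply, smul_eq_mul]
      congr 1
      have h4 : (Matrix.mulVecLin H⁻¹).toContinuousLinearMap (Pi.single i 1)
          = ∑ k, H⁻¹ k i • (Pi.single k 1 : Fin n → ℝ) := by
        funext l
        simp [Pi.single_apply]
      rw [h4, map_sum]
      simp
    have h5 (k : Fin n) := MemLp.comp_mulVec hHi (memLp_fderiv_prod hp hf hf' k)
    have h6 := (memLp_finsetSum Finset.univ
      fun k _ => (h5 k).const_mul (H⁻¹ k i)).const_mul |H.det⁻¹|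
    exact h6.ae_eq (ae_of_all _ fun y => (h2 y).symm)

theorem map_eq_pi_of_iIndepFun {Ω : Type*} [MeasurableSpace Ω] {P : Measure Ω}
    [IsProbabilityMeasure P] {n : ℕ} {s : Ω → Fin n → ℝ} (hs : ∀ i, AEMeasurable (fun ω => s ω i) P)
    (h : iIndepFun (fun (i : Fin n) (ω : Ω) => s ω i) P) :
    P.map s = Measure.pi fun i => P.map fun ω => s ω i :=
  (iIndepFun_iff_map_fun_eq_pi_map hs).1 h

theorem IsSource.aemeasurable_apply {Ω : Type*} [MeasurableSpace Ω] {P : Measure Ω} {n : ℕ}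
    {s : Ω → Fin n → ℝ} (hs : IsSource P s) (i : Fin n) : AEMeasurable (fun ω => s ω i) P :=
  (hs.memLp_two i).1.aemeasurable

theorem IsSource.aemeasurable {Ω : Type*} [MeasurableSpace Ω] {P : Measure Ω} {n : ℕ}
    {s : Ω → Fin n → ℝ} (hs : IsSource P s) : AEMeasurable s P :=
  aemeasurable_pi_iff.2 hs.aemeasurable_apply

theorem map_mix {Ω : Type*} [MeasurableSpace Ω] {P : Measure Ω} {n : ℕ}
    {s : Ω → Fin n → ℝ} (hs : AEMeasurable s P) (H : Matrix (Fin n) (Fin n) ℝ) :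
    P.map (mix H s) = (P.map s).map H.mulVec :=
  (AEMeasurable.map_map_of_aemeasurable (measurable_mulVec H).aemeasurable hs).symm

/-- Independent components whose densities have derivatives in `Lᵖ` form a source for which the
criterion is defined and finite. -/
theorem IsSource.isGFDSource {Ω : Type*} [MeasurableSpace Ω] {P : Measure Ω}
    [IsProbabilityMeasure P] {n : ℕ} {p : ℝ} (hp : 1 ≤ p) {s : Ω → Fin n → ℝ} (hs : IsSource P s)
    (h : ∀ i, HasLpDerivPDF (ENNReal.ofReal p) (P.map fun ω => s ω i)) :
    IsGFDSource P p s where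
  toIsSource := hs
  hasLpGFD H hH := by
    have (i : Fin n) : IsProbabilityMeasure (P.map fun ω => s ω i) :=
      Measure.isProbabilityMeasure_map (hs.aemeasurable_apply i)
    rw [map_mix hs.aemeasurable, map_eq_pi_of_iIndepFun hs.aemeasurable_apply hs.indep]
    exact hasLpGFD_map_mulVec_pi hp h hH

/-! ### The GFD under scalings, permutations and translations. -/

/-- The map permuting the coordinates by `σ`, scaling them by `d` and translating by `b`. -/
def monomialMap {n : ℕ} (d : Fin n → ℝ) (σ : Equiv.Perm (Fin n)) (b : Fin n → ℝ)
    (x : Fin n → ℝ) : Fin n → ℝ :=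
  fun i => d i * x (σ i) + b i

theorem monomialMap_eq {n : ℕ} (d : Fin n → ℝ) (σ : Equiv.Perm (Fin n)) (b x : Fin n → ℝ) :
    monomialMap d σ b x = (Matrix.diagonal d * σ.permMatrix ℝ).mulVec x + b := by
  rw [← Matrix.mulVec_mulVec, Matrix.permMatrix_mulVec]
  funext i
  simp [monomialMap, Matrix.mulVec_diagonal]

theorem measurable_monomialMap {n : ℕ} (d : Fin n → ℝ) (σ : Equiv.Perm (Fin n))
    (b : Fin n → ℝ) : Measurable (monomialMap d σ b) := by
  unfold monomialMap
  fun_prop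

theorem abs_det_monomial {n : ℕ} (d : Fin n → ℝ) (σ : Equiv.Perm (Fin n)) :
    |(Matrix.diagonal d * σ.permMatrix ℝ).det| = ∏ i, |d i| := by
  rw [Matrix.det_mul, Matrix.det_diagonal, Matrix.det_permutation, abs_mul, Finset.abs_prod]
  rcases Int.units_eq_one_or (Equiv.Perm.sign σ) with h | h <;> simp [h]

theorem det_monomial_ne_zero {n : ℕ} {d : Fin n → ℝ} (hd : ∀ i, d i ≠ 0)
    (σ : Equiv.Perm (Fin n)) : (Matrix.diagonal d * σ.permMatrix ℝ).det ≠ 0 := by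
  rw [← abs_pos, abs_det_monomial]
  exact Finset.prod_pos fun i _ => abs_pos.2 (hd i)

theorem map_volume_monomialMap {n : ℕ} {d : Fin n → ℝ} (hd : ∀ i, d i ≠ 0)
    (σ : Equiv.Perm (Fin n)) (b : Fin n → ℝ) :
    (volume : Measure (Fin n → ℝ)).map (monomialMap d σ b)
      = ENNReal.ofReal (∏ i, |d i|)⁻¹ • (volume : Measure (Fin n → ℝ)) := by
  rw [show monomialMap d σ b = _ from funext (monomialMap_eq d σ b),
    map_volume_mulVec_add (det_monomial_ne_zero hd σ), abs_inv, abs_det_monomial]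

/-- The linear part of the inverse of `monomialMap d σ b`. -/
def monomialInvLinear {n : ℕ} (d : Fin n → ℝ) (σ : Equiv.Perm (Fin n)) :
    (Fin n → ℝ) →L[ℝ] (Fin n → ℝ) :=
  ContinuousLinearMap.pi fun j =>
    (d (σ.symm j))⁻¹ • ContinuousLinearMap.proj (R := ℝ) (φ := fun _ : Fin n => ℝ) (σ.symm j)

theorem monomialInvLinear_apply {n : ℕ} (d : Fin n → ℝ) (σ : Equiv.Perm (Fin n))
    (y : Fin n → ℝ) (j : Fin n) :
    monomialInvLinear d σ y j = (d (σ.symm j))⁻¹ * y (σ.symm j) := rfl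

theorem monomialInvLinear_single {n : ℕ} (d : Fin n → ℝ) (σ : Equiv.Perm (Fin n)) (i : Fin n) :
    monomialInvLinear d σ (Pi.single i 1) = (d i)⁻¹ • Pi.single (σ i) 1 := by
  funext j
  rw [monomialInvLinear_apply, Pi.smul_apply, smul_eq_mul]
  by_cases h : j = σ i
  · simp [h]
  · have h' : σ.symm j ≠ i := fun h' => h (by simp [← h'])
    simp [h, h']

theorem monomialInvLinear_monomialMap {n : ℕ} {d : Fin n → ℝ} (hd : ∀ i, d i ≠ 0)
    (σ : Equiv.Perm (Fin n)) (b x : Fin n → ℝ) :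
    monomialInvLinear d σ (monomialMap d σ b x - b) = x := by
  funext j
  simp [monomialInvLinear_apply, monomialMap, hd]

/-- Existence of differentiable joint and marginal densities. -/
def HasDiffPDFs {n : ℕ} (μ : Measure (Fin n → ℝ)) : Prop :=
  (∃ f : (Fin n → ℝ) → ℝ, IsDiffPDF μ f) ∧ ∀ i, ∃ f : ℝ → ℝ, IsDiffPDF (marginal μ i) f

theorem HasLpGFD.hasDiffPDFs {n : ℕ} {p : ℝ} {μ : Measure (Fin n → ℝ)} (h : HasLpGFD p μ) :
    HasDiffPDFs μ := ⟨h.joint, h.marg⟩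

theorem isDiffPDF_diffPDF {E : Type*} [NormedAddCommGroup E] [NormedSpace ℝ E] [MeasureSpace E]
    {μ : Measure E} (h : ∃ f : E → ℝ, IsDiffPDF μ f) : IsDiffPDF μ (diffPDF μ) := by
  rw [diffPDF, dif_pos h]
  exact h.choose_spec

/-- The difference of the product of the marginal densities and of the joint density. -/
def pdfDiff {n : ℕ} (μ : Measure (Fin n → ℝ)) (x : Fin n → ℝ) : ℝ := prodPDF μ x - jointPDF μ x

theorem HasDiffPDFs.differentiable_prodPDF {n : ℕ} {μ : Measure (Fin n → ℝ)}
    (h : HasDiffPDFs μ) : Differentiable ℝ (prodPDF μ) := fun x =>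
  (hasFDerivAt_prod_apply (fun i => (isDiffPDF_diffPDF (h.2 i)).1) x).differentiableAt

theorem HasDiffPDFs.differentiable_jointPDF {n : ℕ} {μ : Measure (Fin n → ℝ)}
    (h : HasDiffPDFs μ) : Differentiable ℝ (jointPDF μ) := (isDiffPDF_diffPDF h.1).1

theorem HasDiffPDFs.differentiable_pdfDiff {n : ℕ} {μ : Measure (Fin n → ℝ)}
    (h : HasDiffPDFs μ) : Differentiable ℝ (pdfDiff μ) :=
  h.differentiable_prodPDF.sub h.differentiable_jointPDF

theorem HasDiffPDFs.gfd_eq {n : ℕ} {μ : Measure (Fin n → ℝ)} (h : HasDiffPDFs μ) (i : Fin n)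
    (x : Fin n → ℝ) : gfd μ i x = fderiv ℝ (pdfDiff μ) x (Pi.single i 1) := by
  have h1 := (h.differentiable_prodPDF x).hasFDerivAt.sub (h.differentiable_jointPDF x).hasFDerivAt
  rw [show pdfDiff μ = prodPDF μ - jointPDF μ from rfl, h1.fderiv]
  rfl

theorem marginal_map_monomialMap {n : ℕ} (μ : Measure (Fin n → ℝ)) (d : Fin n → ℝ)
    (σ : Equiv.Perm (Fin n)) (b : Fin n → ℝ) (i : Fin n) :
    marginal (μ.map (monomialMap d σ b)) i
      = (marginal μ (σ i)).map fun x => d i * x + b i := by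
  rw [marginal_map _ (measurable_monomialMap d σ b), marginal]
  exact (Measure.map_map (g := fun t => d i * t + b i) (f := fun x : Fin n → ℝ => x (σ i)) (by fun_prop)
    (measurable_pi_apply (σ i))).symm

theorem HasDiffPDFs.pdfDiff_monomialMap {n : ℕ} {μ : Measure (Fin n → ℝ)} (h : HasDiffPDFs μ)
    {d : Fin n → ℝ} (hd : ∀ i, d i ≠ 0) (σ : Equiv.Perm (Fin n)) (b : Fin n → ℝ)
    (y : Fin n → ℝ) :
    pdfDiff (μ.map (monomialMap d σ b)) y
      = (∏ i, |d i|)⁻¹ * pdfDiff μ (monomialInvLinear d σ (y - b)) := by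
  have hj := (isDiffPDF_diffPDF h.1).map_of_inverse (measurable_monomialMap d σ b)
    (B := fun y => monomialInvLinear d σ (y - b))
    ((monomialInvLinear d σ).differentiable.comp (differentiable_id.sub_const b))
    (monomialInvLinear_monomialMap hd σ b)
    (inv_nonneg.2 (Finset.prod_nonneg fun i _ => abs_nonneg (d i)))
    (map_volume_monomialMap hd σ b)
  have hm (i : Fin n) : diffPDF (marginal (μ.map (monomialMap d σ b)) i) (y i)
      = |d i|⁻¹ * diffPDF (marginal μ (σ i)) ((d i)⁻¹ * (y i - b i)) := by
    rw [marginal_map_monomialMap, diffPDF_eq ((isDiffPDF_diffPDF (h.2 (σ i))).map_mul_add (hd i) _),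
      abs_inv]
  rw [pdfDiff, pdfDiff, jointPDF, diffPDF_eq hj, mul_sub]
  congr 1
  simp only [prodPDF, hm, Finset.prod_mul_distrib, Finset.prod_inv_distrib]
  congr 1
  rw [← Equiv.prod_comp σ fun j => diffPDF (marginal μ j) (monomialInvLinear d σ (y - b) j)]
  simp [monomialInvLinear_apply]

theorem HasDiffPDFs.map_monomialMap {n : ℕ} {μ : Measure (Fin n → ℝ)} (h : HasDiffPDFs μ)
    {d : Fin n → ℝ} (hd : ∀ i, d i ≠ 0) (σ : Equiv.Perm (Fin n)) (b : Fin n → ℝ) :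
    HasDiffPDFs (μ.map (monomialMap d σ b)) := by
  refine ⟨?_, fun i => ?_⟩
  · have h1 := (isDiffPDF_diffPDF h.1).map_mulVec_add (det_monomial_ne_zero hd σ) b
    simp only [← monomialMap_eq] at h1
    exact ⟨_, h1⟩
  · rw [marginal_map_monomialMap]
    exact ⟨_, (isDiffPDF_diffPDF (h.2 (σ i))).map_mul_add (hd i) _⟩

theorem HasDiffPDFs.gfd_monomialMap {n : ℕ} {μ : Measure (Fin n → ℝ)} (h : HasDiffPDFs μ)
    {d : Fin n → ℝ} (hd : ∀ i, d i ≠ 0) (σ : Equiv.Perm (Fin n)) (b : Fin n → ℝ)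
    (i : Fin n) (y : Fin n → ℝ) :
    gfd (μ.map (monomialMap d σ b)) i y
      = (∏ i, |d i|)⁻¹ * (d i)⁻¹ * gfd μ (σ i) (monomialInvLinear d σ (y - b)) := by
  have hL : HasFDerivAt (fun y => monomialInvLinear d σ (y - b)) (monomialInvLinear d σ) y := by
    simpa using ((monomialInvLinear d σ).hasFDerivAt (x := y - b)).comp
      (f := fun y => y - b) y (hasFDerivAt_sub_const b)
  have h1 : HasFDerivAt (pdfDiff (μ.map (monomialMap d σ b))) _ y :=
    (((h.differentiable_pdfDiff _).hasFDerivAt.comp y hL).const_mul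
      (∏ i, |d i|)⁻¹).congr_of_eventuallyEq
      (Eventually.of_forall (h.pdfDiff_monomialMap hd σ b))
  rw [(h.map_monomialMap hd σ b).gfd_eq, h1.fderiv, h.gfd_eq, smul_apply,
    ContinuousLinearMap.comp_apply, monomialInvLinear_single, map_smul, smul_eq_mul, smul_eq_mul,
    mul_assoc]

/-- The integrals whose sum is the `p`-th power of the norm of the GFD. -/
def gfdIntegral {n : ℕ} (p : ℝ) (μ : Measure (Fin n → ℝ)) (i : Fin n) : ℝ := ∫ x, |gfd μ i x| ^ p

theorem gfdIntegral_nonneg {n : ℕ} (p : ℝ) (μ : Measure (Fin n → ℝ)) (i : Fin n) :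
    0 ≤ gfdIntegral p μ i := integral_nonneg fun _ => by positivity

theorem gfdNorm_eq {n : ℕ} (p : ℝ) (μ : Measure (Fin n → ℝ)) :
    gfdNorm p μ = (∑ i, gfdIntegral p μ i) ^ (1 / p) := rfl

/-- With `c = ∏ i, |d i|`, the densities contribute `c ^ (-p)`, the derivative in direction `i`
contributes `|d i| ^ (-p)`, and the change of variables contributes `c`. Normalization, trivial
filters and unnormalized scaling are all instances. -/
theorem HasDiffPDFs.gfdIntegral_monomialMap {n : ℕ} (p : ℝ) {μ : Measure (Fin n → ℝ)}
    (h : HasDiffPDFs μ) {d : Fin n → ℝ} (hd : ∀ i, d i ≠ 0) (σ : Equiv.Perm (Fin n))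
    (b : Fin n → ℝ) (i : Fin n) :
    gfdIntegral p (μ.map (monomialMap d σ b)) i
      = (∏ i, |d i|) ^ (1 - p) * |d i| ^ (-p) * gfdIntegral p μ (σ i) := by
  set c := ∏ i, |d i| with hc
  have hc0 : 0 < c := Finset.prod_pos fun i _ => abs_pos.2 (hd i)
  have hmeas : AEStronglyMeasurable (fun y => |gfd μ (σ i) (monomialInvLinear d σ (y - b))| ^ p)
      ((volume : Measure (Fin n → ℝ)).map (monomialMap d σ b)) := by
    have h1 : Measurable (gfd μ (σ i)) := by
      rw [show gfd μ (σ i) = _ from funext (h.gfd_eq (σ i))]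
      exact measurable_fderiv_apply_const ℝ _ _
    have h2 : Measurable fun y => monomialInvLinear d σ (y - b) :=
      (monomialInvLinear d σ).measurable.comp (measurable_id.sub_const b)
    have h3 := h1.comp h2
    have h4 : Measurable fun y => |gfd μ (σ i) (monomialInvLinear d σ (y - b))| ^ p :=
      (continuous_abs.measurable.comp h3).pow_const p
    exact h4.aestronglyMeasurable
  have hint := integral_map (measurable_monomialMap d σ b).aemeasurable hmeas
  rw [map_volume_monomialMap hd, integral_smul_measure] at hint
  simp only [monomialInvLinear_monomialMap hd] at hint
  rw [ENNReal.toReal_ofReal (inv_nonneg.2 hc0.le), smul_eq_mul, inv_mul_eq_iff_eq_mul₀ hc0.ne'] at hint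
  have hdi := abs_pos.2 (hd i)
  rw [gfdIntegral, gfdIntegral]
  simp only [h.gfd_monomialMap hd σ b, abs_mul, abs_inv, ← hc, abs_of_pos hc0]
  have h5 (y : ℝ) (hy : 0 ≤ y) : (c⁻¹ * |d i|⁻¹ * y) ^ p = c ^ (-p) * |d i| ^ (-p) * y ^ p := by
    rw [Real.mul_rpow (by positivity) hy, Real.mul_rpow (by positivity) (by positivity),
      Real.inv_rpow hc0.le, Real.inv_rpow hdi.le, Real.rpow_neg hc0.le, Real.rpow_neg hdi.le]
  simp only [h5 _ (abs_nonneg _)]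
  rw [integral_const_mul, hint, sub_eq_add_neg, Real.rpow_add hc0, Real.rpow_one]
  ring

/-! ### A vanishing gradient function difference means independence -/

/-- A differentiable function whose gradient vanishes almost everywhere is constant. -/
theorem apply_add_eq_of_fderiv_ae_eq_zero {n : ℕ} {D : (Fin n → ℝ) → ℝ}
    (hD : Differentiable ℝ D) (h0 : ∀ᵐ x, fderiv ℝ D x = 0) (v x : Fin n → ℝ) :
    D (x + v) = D x := by
  have hmeas : MeasurableSet {z : (Fin n → ℝ) × ℝ | fderiv ℝ D (z.1 + z.2 • v) = 0} := by
    have h1 : Measurable fun z : (Fin n → ℝ) × ℝ => fderiv ℝ D (z.1 + z.2 • v) :=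
      (measurable_fderiv ℝ D).comp (by fun_prop)
    exact h1 (measurableSet_singleton 0)
  -- A given segment may lie inside the exceptional null set. By Fubini, for almost every `x` the
  -- gradient vanishes at almost every point of the line through `x` in direction `v`; this gives
  -- equality for almost all `x`, and continuity extends it to all.
  have hprod : ∀ᵐ x : Fin n → ℝ, ∀ᵐ t : ℝ, fderiv ℝ D (x + t • v) = 0 := by
    rw [Measure.ae_ae_comm (p := fun x t => fderiv ℝ D (x + t • v) = 0) hmeas]
    exact ae_of_all _ fun t =>
      (measurePreserving_add_right volume (t • v)).quasiMeasurePreserving.ae h0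
  have hae : ∀ᵐ x : Fin n → ℝ, D (x + v) = D x := by
    filter_upwards [hprod] with x hx
    have hderiv (t : ℝ) : HasDerivAt (fun t : ℝ => D (x + t • v)) (fderiv ℝ D (x + t • v) v) t := by
      have h2 : HasDerivAt (fun t : ℝ => x + t • v) v t := by
        simpa using ((hasDerivAt_id t).smul_const v).const_add x
      exact (hD _).hasFDerivAt.comp_hasDerivAt t h2
    have hz : (fun t : ℝ => fderiv ℝ D (x + t • v) v) =ᵐ[volume] fun _ => 0 := by
      filter_upwards [hx] with t ht
      simp [ht]
    have hi : IntervalIntegrable (fun t : ℝ => fderiv ℝ D (x + t • v) v) volume 0 1 := by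
      rw [intervalIntegrable_iff]
      exact (integrable_zero ℝ ℝ _).congr (ae_restrict_of_ae hz.symm)
    have h3 := intervalIntegral.integral_eq_sub_of_hasDerivAt (fun t _ => hderiv t) hi
    rw [intervalIntegral.integral_congr_ae (g := fun _ => 0) (hz.mono fun t ht _ => ht)] at h3
    simp at h3
    linarith
  have hc : Continuous fun x => D (x + v) := hD.continuous.comp (by fun_prop)
  exact congrFun ((Continuous.ae_eq_iff_eq volume hc hD.continuous).1 hae) x

theorem HasLpGFD.eq_pi_of_gfdIntegral_eq_zero {n : ℕ} [NeZero n] {p : ℝ} (hp : 1 ≤ p)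
    {μ : Measure (Fin n → ℝ)} [IsProbabilityMeasure μ] (h : HasLpGFD p μ)
    (h0 : ∀ i, gfdIntegral p μ i = 0) : μ = Measure.pi (marginal μ) := by
  have hd := h.hasDiffPDFs
  have hae (i : Fin n) : ∀ᵐ x, gfd μ i x = 0 := by
    have h1 := (integral_eq_zero_iff_of_nonneg (fun x => by positivity)
      ((memLp_ofReal_iff hp (h.memLp i).1).1 (h.memLp i))).1 (h0 i)
    filter_upwards [h1] with x hx
    have h2 := (Real.rpow_eq_zero (abs_nonneg _) (by linarith)).1 hx
    exact abs_eq_zero.1 h2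
  have hfd : ∀ᵐ x, fderiv ℝ (pdfDiff μ) x = 0 := by
    filter_upwards [ae_all_iff.2 hae] with x hx
    have h3 : (fderiv ℝ (pdfDiff μ) x).toLinearMap = 0 := by
      refine LinearMap.pi_ext' fun i => LinearMap.ext_ring ?_
      simpa [← hd.gfd_eq] using hx i
    exact ContinuousLinearMap.coe_injective h3
  have hconst (x : Fin n → ℝ) : pdfDiff μ x = pdfDiff μ 0 := by
    simpa using apply_add_eq_of_fderiv_ae_eq_zero hd.differentiable_pdfDiff hfd x 0
  have hprodPDF := IsDiffPDF.pi fun i => isDiffPDF_diffPDF (h.marg i)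
  have hjointPDF := isDiffPDF_diffPDF h.joint
  have hint : Integrable (pdfDiff μ) := hprodPDF.integrable.sub hjointPDF.integrable
  rw [show pdfDiff μ = fun _ => pdfDiff μ 0 from funext hconst] at hint
  have hzero : pdfDiff μ 0 = 0 := by
    -- A nonzero constant is integrable only on a space of finite measure, and `ℝⁿ` with `n ≠ 0` has
    -- infinite volume.
    rcases integrable_const_iff.1 hint with h4 | h4
    · exact h4
    · exact absurd h4.measure_univ_lt_top (by simp)
  rw [hprodPDF.2.2]
  conv_lhs => rw [hjointPDF.2.2]
  congr 1
  funext x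
  have h5 := hconst x
  rw [hzero, pdfDiff, sub_eq_zero] at h5
  rw [← jointPDF, ← h5]
  rfl

theorem gfd_pi_eq_zero {n : ℕ} {m : Fin n → Measure ℝ} [∀ i, IsProbabilityMeasure (m i)]
    (h : HasDiffPDFs (Measure.pi m)) (i : Fin n) (x : Fin n → ℝ) :
    gfd (Measure.pi m) i x = 0 := by
  have h1 : prodPDF (Measure.pi m) = jointPDF (Measure.pi m) := by
    have h2 := IsDiffPDF.pi fun i => isDiffPDF_diffPDF (marginal_pi m i ▸ h.2 i)
    funext x
    rw [jointPDF, diffPDF_eq h2, prodPDF]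
    simp only [marginal_pi]
  rw [gfd, gpf, gjf, h1, sub_self]

/-! ### The Darmois theorem for finite variance, by characteristic functions. -/

/-- Formally `(log g)'' = 0`, but `g` is not known to be nonvanishing. So the set where `g = 1` and
`g' = 0` is shown to be clopen: near each of its points `g ≠ 0`, and there `g' / g` has zero
derivative. -/
theorem eq_one_of_mul_deriv2_eq_sq {g g' g'' : ℝ → ℂ} (hg : ∀ w, HasDerivAt g (g' w) w)
    (hg' : ∀ w, HasDerivAt g' (g'' w) w) (h : ∀ w, g w * g'' w = g' w ^ 2) (h0 : g 0 = 1)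
    (h0' : g' 0 = 0) (w : ℝ) : g w = 1 := by
  have hgc : Continuous g := continuous_iff_continuousAt.2 fun w => (hg w).continuousAt
  have hgc' : Continuous g' := continuous_iff_continuousAt.2 fun w => (hg' w).continuousAt
  have hcl : IsClosed {w | g w = 1 ∧ g' w = 0} :=
    (isClosed_eq hgc continuous_const).inter (isClosed_eq hgc' continuous_const)
  have hop : IsOpen {w | g w = 1 ∧ g' w = 0} := by
    rw [Metric.isOpen_iff]
    rintro a ⟨ha, ha'⟩
    have h1 : {w | g w ≠ 0} ∈ 𝓝 a :=
      (isOpen_ne_fun hgc continuous_const).mem_nhds (by simp [ha])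
    obtain ⟨ε, hε, hball⟩ := Metric.mem_nhds_iff.1 h1
    have hpre : IsPreconnected (Metric.ball a ε) := (convex_ball a ε).isPreconnected
    have hmem : a ∈ Metric.ball a ε := Metric.mem_ball_self hε
    have hq (w) (hw : w ∈ Metric.ball a ε) : HasDerivAt (fun w => g' w / g w) 0 w := by
      have h2 := (hg' w).div (hg w) (hball hw)
      rwa [show g'' w * g w - g' w * g' w = 0 by rw [mul_comm, h w]; ring, zero_div] at h2
    have hz (w) (hw : w ∈ Metric.ball a ε) : g' w = 0 := by
      have h3 := Metric.isOpen_ball.is_const_of_deriv_eq_zero hpre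
        (fun w hw => (hq w hw).differentiableAt.differentiableWithinAt)
        (fun w hw => (hq w hw).deriv) hw hmem
      rw [ha', zero_div] at h3
      exact (div_eq_zero_iff.1 h3).resolve_right (hball hw)
    refine ⟨ε, hε, fun w hw => ⟨?_, hz w hw⟩⟩
    rw [← ha]
    refine Metric.isOpen_ball.is_const_of_deriv_eq_zero hpre
        (fun w hw => (hg w).differentiableAt.differentiableWithinAt)
        (fun w hw => ?_) hw hmem
    rw [(hg w).deriv, hz w hw]
    rfl
  have huniv := IsClopen.eq_univ ⟨hcl, hop⟩ ⟨0, h0, h0'⟩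
  exact (huniv.symm ▸ mem_univ w : w ∈ {w | g w = 1 ∧ g' w = 0}).1

/-- The differential equation satisfied by the characteristic function of a centered Gaussian. -/
theorem eq_cexp_of_mul_deriv2_sub_sq {ψ ψ' ψ'' : ℝ → ℂ} (hψ : ∀ w, HasDerivAt ψ (ψ' w) w)
    (hψ' : ∀ w, HasDerivAt ψ' (ψ'' w) w) {v : ℝ}
    (h : ∀ w, ψ w * ψ'' w - ψ' w ^ 2 = -v * ψ w ^ 2) (h0 : ψ 0 = 1) (h0' : ψ' 0 = 0) (w : ℝ) :
    ψ w = Complex.exp (-(v * w ^ 2 / 2)) := by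
  have hw1 (w : ℝ) : HasDerivAt (fun w : ℝ => (w : ℂ)) 1 w := (hasDerivAt_id w).ofReal_comp
  have hE (w : ℝ) : HasDerivAt (fun w : ℝ => Complex.exp ((v : ℂ) * (w : ℂ) ^ 2 / 2))
      (Complex.exp ((v : ℂ) * (w : ℂ) ^ 2 / 2) * (v * w)) w := by
    have h1 := ((((hw1 w).pow 2).const_mul (v : ℂ)).div_const 2).cexp
    convert! h1 using 1
    simp
    ring
  have h1 (w : ℝ) : HasDerivAt (fun w : ℝ => ψ w * Complex.exp ((v : ℂ) * (w : ℂ) ^ 2 / 2))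
      ((ψ' w + v * w * ψ w) * Complex.exp ((v : ℂ) * (w : ℂ) ^ 2 / 2)) w := by
    convert! (hψ w).mul (hE w) using 1
    ring
  have h2 (w : ℝ) : HasDerivAt
      (fun w : ℝ => (ψ' w + v * w * ψ w) * Complex.exp ((v : ℂ) * (w : ℂ) ^ 2 / 2))
      ((ψ'' w + v * ψ w + v * w * ψ' w + v * w * (ψ' w + v * w * ψ w))
        * Complex.exp ((v : ℂ) * (w : ℂ) ^ 2 / 2)) w := by
    convert! ((hψ' w).add (((hw1 w).const_mul (v : ℂ)).mul (hψ w))).mul (hE w) using 1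
    simp only [Pi.add_apply, Pi.mul_apply]
    ring
  -- Multiplying `ψ` by the inverse Gaussian factor cancels the constant `-v` in `(log ψ)'' = -v`.
  have h3 := eq_one_of_mul_deriv2_eq_sq h1 h2 (fun w => by
      linear_combination (Complex.exp ((v : ℂ) * (w : ℂ) ^ 2 / 2) ^ 2) * h w) (by simp [h0]) (by simp [h0']) w
  rw [Complex.exp_neg]
  exact eq_inv_of_mul_eq_one_left h3

/-- The moments weighted by `exp(iwx)` are, up to powers of `i`, the derivatives of the
characteristic function `φ`, so the hypothesis reads `φ φ'' - φ' ^ 2 = -v φ ^ 2`. The case `v = 0`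
gives a point mass, a degenerate Gaussian. -/
theorem gaussian_of_charFun_ode {μ : Measure ℝ} [IsProbabilityMeasure μ] (hμ : MemLp id 2 μ)
    (h0 : ∫ x, x ∂μ = 0)
    (h : ∀ w : ℝ, (∫ x, Complex.exp (w * x * Complex.I) ∂μ)
        * (∫ x, (x : ℂ) ^ 2 * Complex.exp (w * x * Complex.I) ∂μ)
        - (∫ x, (x : ℂ) * Complex.exp (w * x * Complex.I) ∂μ) ^ 2
      = ((∫ x, x ^ 2 ∂μ : ℝ) : ℂ) * (∫ x, Complex.exp (w * x * Complex.I) ∂μ) ^ 2) :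
    IsGaussian μ := by
  set v : ℝ := ∫ x, x ^ 2 ∂μ with hv
  have hv0 : 0 ≤ v := integral_nonneg fun x => sq_nonneg x
  have hC : ContDiff ℝ ((2 : ℕ) : WithTop ℕ∞) (charFun μ) := by
    exact_mod_cast contDiff_charFun (n := 2) (by exact_mod_cast hμ)
  have hI1 (w : ℝ) : deriv (charFun μ) w
      = Complex.I * ∫ x, (x : ℂ) * Complex.exp (w * x * Complex.I) ∂μ := by
    have h1 := iteratedDeriv_charFun (μ := μ) (n := 1) (t := w)
      (by exact_mod_cast hμ.mono_exponent one_le_two)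
    simpa [iteratedDeriv_one] using h1
  have hI2 (w : ℝ) : deriv (deriv (charFun μ)) w
      = - ∫ x, (x : ℂ) ^ 2 * Complex.exp (w * x * Complex.I) ∂μ := by
    have h1 := iteratedDeriv_charFun (μ := μ) (n := 2) (t := w) (by exact_mod_cast hμ)
    rw [iteratedDeriv_succ, iteratedDeriv_one] at h1
    simpa using h1
  have hd1 (w : ℝ) : HasDerivAt (charFun μ) (deriv (charFun μ) w) w :=
    (hC.differentiable (by norm_num) w).hasDerivAt
  have hd2 (w : ℝ) : HasDerivAt (deriv (charFun μ)) (deriv (deriv (charFun μ)) w) w := by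
    have h1 : ContDiff ℝ ((1 : WithTop ℕ∞) + 1) (charFun μ) := by
      convert! hC using 1
    exact (((contDiff_succ_iff_deriv.1 h1).2.2.differentiable (by norm_num)) w).hasDerivAt
  have hsol := eq_cexp_of_mul_deriv2_sub_sq hd1 hd2 (v := v) (fun w => by
    rw [hI1, hI2, charFun_apply_real, mul_pow, Complex.I_sq]
    linear_combination -(h w)) (by simp)
    (by
      rw [hI1]
      have : (∫ x, (x : ℂ) ∂μ) = ((∫ x, x ∂μ : ℝ) : ℂ) := integral_ofReal
      simp [this, h0])
  have hμ' : μ = gaussianReal 0 v.toNNReal := by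
    refine Measure.ext_of_charFun (funext fun w => ?_)
    rw [hsol, charFun_gaussianReal, Real.coe_toNNReal _ hv0]
    simp
  rw [hμ']
  infer_instance

section Darmois

variable {Ω : Type*} [MeasurableSpace Ω] {P : Measure Ω} {n : ℕ}

theorem integral_mul_mul_prod_of_iIndepFun {Y : Fin n → Ω → ℝ} (hY : iIndepFun Y P)
    (hYm : ∀ i, AEMeasurable (Y i) P) (e : Fin n → ℝ → ℂ) (he : ∀ i, Measurable (e i))
    {i k : Fin n} (hik : i ≠ k) :
    (∫ ω, (Y i ω : ℂ) * (Y k ω : ℂ) * ∏ m, e m (Y m ω) ∂P) * (∫ ω, ∏ m, e m (Y m ω) ∂P)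
      = (∫ ω, (Y i ω : ℂ) * ∏ m, e m (Y m ω) ∂P) * ∫ ω, (Y k ω : ℂ) * ∏ m, e m (Y m ω) ∂P := by
  -- The four integrals are the cases `S = {i, k}, ∅, {i}, {k}`. Each splits into one-variable
  -- integrals, and the two sides agree index by index.
  have key (S : Finset (Fin n)) : ∫ ω, (∏ m ∈ S, (Y m ω : ℂ)) * ∏ m, e m (Y m ω) ∂P
      = ∏ m, ∫ ω, (if m ∈ S then (Y m ω : ℂ) else 1) * e m (Y m ω) ∂P := by
    rw [← hY.integral_fun_prod_comp (f := fun m (y : ℝ) =>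
      (if m ∈ S then (y : ℂ) else 1) * e m y) hYm]
    · congr 1
      funext ω
      rw [Finset.prod_mul_distrib, Finset.prod_ite_mem, Finset.univ_inter]
    · intro m
      by_cases hm : m ∈ S <;> simp only [hm, if_true, if_false] <;>
        exact (Measurable.mul (by fun_prop) (he m)).aestronglyMeasurable
  have h1 := key {i, k}
  have h2 := key ∅
  have h3 := key {i}
  have h4 := key {k}
  simp only [Finset.prod_pair hik, Finset.prod_singleton, Finset.prod_empty, one_mul] at h1 h2 h3 h4
  rw [h1, h2, h3, h4, ← Finset.prod_mul_distrib, ← Finset.prod_mul_distrib]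
  refine Finset.prod_congr rfl fun m _ => ?_
  by_cases hi : m = i
  · subst hi
    simp [hik]
  · by_cases hk : m = k
    · subst hk
      simp [hi]
      ring
    · simp [hi, hk]

/-- Expectations weighted by `E w = exp(iw X j)` are computed twice. Since `X j` is a linear
combination of the independent `Y m`, the weight factors over `m`, which gives `E[Y i Y k E] E[E] =
E[Y i E] E[Y k E]`. Expanding in the independent centered `X l` leaves only moments of `X j` and the
constant `C`: a differential equation for the characteristic function of `X j`. -/
theorem isGaussian_of_iIndepFun_mixture [IsProbabilityMeasure P] {X : Fin n → Ω → ℝ}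
    (hX : iIndepFun X P) (hX2 : ∀ l, MemLp (X l) 2 P) (hX0 : ∀ l, ∫ ω, X l ω ∂P = 0)
    (hvar : ∀ l, ∫ ω, X l ω ^ 2 ∂P ≠ 0) {H : Matrix (Fin n) (Fin n) ℝ} (hH : H.det ≠ 0)
    (hY : iIndepFun (fun i ω => ∑ l, H i l * X l ω) P) {i k j : Fin n} (hik : i ≠ k)
    (hij : H i j ≠ 0) (hkj : H k j ≠ 0) :
    IsGaussian (P.map (X j)) ∧ ∃ l, l ≠ j ∧ H i l ≠ 0 ∧ H k l ≠ 0 := by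
  have hXm (l : Fin n) : AEMeasurable (X l) P := (hX2 l).1.aemeasurable
  set v : Fin n → ℝ := fun l => ∫ ω, X l ω ^ 2 ∂P with hv
  set C : ℝ := ∑ l ∈ Finset.univ.erase j, H i l * H k l * v l with hC
  let E (w : ℝ) (ω : Ω) : ℂ := Complex.exp (w * X j ω * Complex.I)
  have hEm (w : ℝ) : AEStronglyMeasurable (E w) P := by
    have h1 : Measurable fun x : ℝ => Complex.exp (w * x * Complex.I) := by fun_prop
    exact (h1.comp_aemeasurable (hXm j)).aestronglyMeasurable
  have hEb (w : ℝ) (ω : Ω) : ‖E w ω‖ ≤ 1 := by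
    simp only [E]
    rw [← Complex.ofReal_mul, Complex.norm_exp_ofReal_mul_I]
  have hint1 (w : ℝ) (l : Fin n) : Integrable (fun ω => (X l ω : ℂ) * E w ω) P :=
    ((hX2 l).integrable one_le_two).ofReal.mul_bdd (hEm w) (ae_of_all _ (hEb w))
  have hint2 (w : ℝ) (a b : Fin n) : Integrable (fun ω => (X a ω : ℂ) * X b ω * E w ω) P := by
    have h1 : Integrable (fun ω => (X a ω : ℂ) * X b ω) P := by
      simpa using ((hX2 a).integrable_mul (hX2 b)).ofReal (𝕜 := ℂ)
    exact h1.mul_bdd (hEm w) (ae_of_all _ (hEb w))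
  have hexp (w : ℝ) : Measurable fun x : ℝ => Complex.exp (w * x * Complex.I) := by fun_prop
  have hm1 (w : ℝ) {l : Fin n} (hl : l ≠ j) : ∫ ω, (X l ω : ℂ) * E w ω ∂P = 0 := by
    rw [(hX.indepFun hl).integral_fun_comp_mul_comp (f := fun x : ℝ => (x : ℂ))
      (g := fun x : ℝ => Complex.exp (w * x * Complex.I)) (hXm l) (hXm j)
      Complex.measurable_ofReal.aestronglyMeasurable (hexp w).aestronglyMeasurable,
      integral_complex_ofReal, hX0 l]
    simp
  have hm2 (w : ℝ) {l : Fin n} (hl : l ≠ j) :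
      ∫ ω, (X l ω : ℂ) * X l ω * E w ω ∂P = v l * ∫ ω, E w ω ∂P := by
    rw [(hX.indepFun hl).integral_fun_comp_mul_comp (f := fun x : ℝ => (x : ℂ) * x)
      (g := fun x : ℝ => Complex.exp (w * x * Complex.I)) (hXm l) (hXm j)
      (by fun_prop) (hexp w).aestronglyMeasurable, hv]
    simp only [← pow_two, ← Complex.ofReal_pow, integral_complex_ofReal]
    rfl
  have hm3 (w : ℝ) {a b : Fin n} (hab : a ≠ b) : ∫ ω, (X a ω : ℂ) * X b ω * E w ω ∂P = 0 := by
    have h1 := hX.integral_fun_prod_comp (f := fun m (x : ℝ) =>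
      (if m = a then (x : ℂ) else 1) * (if m = b then (x : ℂ) else 1)
        * (if m = j then Complex.exp (w * x * Complex.I) else 1)) hXm (fun m => by
      refine Measurable.aestronglyMeasurable (Measurable.mul (Measurable.mul ?_ ?_) ?_) <;>
        split_ifs <;> fun_prop)
    simp only [Finset.prod_mul_distrib, Finset.prod_ite_eq', Finset.mem_univ, if_true] at h1
    refine h1.trans ?_
    by_cases haj : a = j
    · refine Finset.prod_eq_zero (Finset.mem_univ b) ?_
      have hbj : b ≠ j := fun h => hab (haj.trans h.symm)
      simp [hab.symm, hbj, integral_complex_ofReal, hX0]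
    · refine Finset.prod_eq_zero (Finset.mem_univ a) ?_
      simp [hab, haj, integral_complex_ofReal, hX0]
  have hA (w : ℝ) (i : Fin n) : ∫ ω, ((∑ l, H i l * X l ω : ℝ) : ℂ) * E w ω ∂P
      = H i j * ∫ ω, (X j ω : ℂ) * E w ω ∂P := by
    have h1 (ω : Ω) : ((∑ l, H i l * X l ω : ℝ) : ℂ) * E w ω
        = ∑ l, (H i l : ℂ) * ((X l ω : ℂ) * E w ω) := by
      rw [Complex.ofReal_sum, Finset.sum_mul]
      refine Finset.sum_congr rfl fun l _ => ?_
      push_cast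
      ring
    simp only [h1]
    rw [integral_finsetSum _ fun l _ => (hint1 w l).const_mul _, Finset.sum_eq_single j]
    · rw [integral_const_mul]
    · intro l _ hl
      rw [integral_const_mul, hm1 w hl, mul_zero]
    · simp
  have hB (w : ℝ) : ∫ ω, ((∑ l, H i l * X l ω : ℝ) : ℂ) * ((∑ l, H k l * X l ω : ℝ) : ℂ)
        * E w ω ∂P
      = H i j * H k j * (∫ ω, (X j ω : ℂ) ^ 2 * E w ω ∂P) + C * ∫ ω, E w ω ∂P := by
    have h1 (ω : Ω) : ((∑ l, H i l * X l ω : ℝ) : ℂ) * ((∑ l, H k l * X l ω : ℝ) : ℂ) * E w ω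
        = ∑ a, ∑ b, (H i a * H k b : ℂ) * ((X a ω : ℂ) * X b ω * E w ω) := by
      rw [Complex.ofReal_sum, Complex.ofReal_sum, Finset.sum_mul_sum, Finset.sum_mul]
      refine Finset.sum_congr rfl fun a _ => ?_
      rw [Finset.sum_mul]
      refine Finset.sum_congr rfl fun b _ => ?_
      push_cast
      ring
    simp only [h1]
    rw [integral_finsetSum _ fun a _ => integrable_finsetSum _ fun b _ => (hint2 w a b).const_mul _]
    have h2 (a : Fin n) : ∫ ω, ∑ b, (H i a * H k b : ℂ) * ((X a ω : ℂ) * X b ω * E w ω) ∂P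
        = (H i a * H k a : ℂ) * ∫ ω, (X a ω : ℂ) * X a ω * E w ω ∂P := by
      rw [integral_finsetSum _ fun b _ => (hint2 w a b).const_mul _, Finset.sum_eq_single a]
      · rw [integral_const_mul]
      · intro b _ hb
        rw [integral_const_mul, hm3 w hb.symm, mul_zero]
      · simp
    simp only [h2]
    rw [← Finset.add_sum_erase _ _ (Finset.mem_univ j), hC, Complex.ofReal_sum, Finset.sum_mul]
    simp only [pow_two]
    congr 1
    refine Finset.sum_congr rfl fun l hl => ?_
    rw [hm2 w (Finset.ne_of_mem_erase hl)]
    push_cast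
    ring
  have hprod (w : ℝ) (ω : Ω) : ∏ m, Complex.exp
      (w * (H⁻¹ j m : ℝ) * ((∑ l, H m l * X l ω : ℝ) : ℂ) * Complex.I) = E w ω := by
    rw [← Complex.exp_sum]
    simp only [E]
    have h1 : ∑ m, H⁻¹ j m * (∑ l, H m l * X l ω) = X j ω := by
      have h2 : (H⁻¹.mulVec (H.mulVec fun l => X l ω)) j = X j ω := by
        simp [Matrix.nonsing_inv_mul _ (isUnit_iff_ne_zero.2 hH)]
      exact h2
    rw [← Finset.sum_mul, ← h1, Complex.ofReal_sum, Finset.mul_sum]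
    congr 3
    funext m
    push_cast
    ring
  have hfact (w : ℝ) := integral_mul_mul_prod_of_iIndepFun hY
    (fun i => by
      have h1 := Finset.aemeasurable_fun_sum Finset.univ fun l _ => (hXm l).const_mul (H i l)
      exact h1)
    (fun m y => Complex.exp (w * (H⁻¹ j m : ℝ) * (y : ℂ) * Complex.I)) (fun m => by fun_prop) hik
  simp only [hprod, hA, hB] at hfact
  have hE0 : ∀ ω, E 0 ω = 1 := fun ω => by simp [E]
  -- At `w = 0` the identity says that `Y i` and `Y k` are uncorrelated. This determines `C`, and
  -- since the `j` term is nonzero, some other source must occur in both.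
  have hc0 : H i j * H k j * v j + C = 0 := by
    have h0 := hfact 0
    have h1 : ∫ ω, (X j ω : ℂ) ^ 2 ∂P = (v j : ℂ) := by
      simp only [← Complex.ofReal_pow, integral_complex_ofReal, hv]
    simp only [hE0, mul_one, integral_complex_ofReal, hX0, h1] at h0
    simp at h0
    exact_mod_cast h0
  refine ⟨?_, ?_⟩
  · have := Measure.isProbabilityMeasure_map (μ := P) (hXm j)
    have hmap {f : ℝ → ℂ} (hf : Measurable f) : ∫ x, f x ∂(P.map (X j)) = ∫ ω, f (X j ω) ∂P :=
      integral_map (hXm j) hf.aestronglyMeasurable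
    refine gaussian_of_charFun_ode ?_ ?_ fun w => ?_
    · exact (memLp_map_measure_iff aestronglyMeasurable_id (hXm j)).2 (hX2 j)
    · rw [integral_map (hXm j) (by fun_prop)]
      exact hX0 j
    · rw [hmap (by fun_prop), hmap (by fun_prop), hmap (by fun_prop),
        integral_map (hXm j) (by fun_prop)]
      have h1 := hfact w
      have h2 : (C : ℂ) = - (H i j * H k j * v j) := by
        rw [eq_neg_iff_add_eq_zero, add_comm]
        exact_mod_cast hc0
      have h3 : (H i j * H k j : ℂ) ≠ 0 := by exact_mod_cast mul_ne_zero hij hkj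
      rw [h2] at h1
      refine mul_left_cancel₀ h3 ?_
      simp only [E, hv] at h1 ⊢
      linear_combination h1
  · by_contra hne
    push Not at hne
    have hCz : C = 0 := Finset.sum_eq_zero fun l hl => by
      by_cases h : H i l = 0
      · simp [h]
      · simp [hne l (Finset.ne_of_mem_erase hl) h]
    rw [hCz, add_zero] at hc0
    exact mul_ne_zero (mul_ne_zero hij hkj) (hvar j) hc0

end Darmois

/-! ### Trivial filters and laws of mixtures. -/

/-- Choosing a nonzero entry in each row gives an injective, hence bijective, map from rows to
columns, and no column has room for another nonzero entry. -/
theorem mem_trivialFilters_of_col {n : ℕ} {H : Matrix (Fin n) (Fin n) ℝ} (hH : H.det ≠ 0)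
    (hcol : ∀ i k j, H i j ≠ 0 → H k j ≠ 0 → i = k) : H ∈ trivialFilters n := by
  have hrow (i : Fin n) : ∃ j, H i j ≠ 0 := by
    by_contra h
    push Not at h
    exact hH (Matrix.det_eq_zero_of_row_eq_zero i h)
  choose c hc using hrow
  have hinj : Function.Injective c := fun i k h => hcol i k (c i) (hc i) (h ▸ hc k)
  have hbij := Finite.injective_iff_bijective.1 hinj
  refine ⟨fun i => H i (c i), Equiv.ofBijective c hbij, hc, ?_⟩
  ext i j
  rw [Matrix.diagonal_mul]
  by_cases h : j = c i
  · subst h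
    simp [PEquiv.toMatrix_apply]
  · obtain ⟨k, rfl⟩ := hbij.2 j
    have hki : i ≠ k := fun h' => h (h' ▸ rfl)
    have h0 : H i (c k) = 0 := by
      by_contra h'
      exact hki (hcol i k (c k) h' (hc k))
    simp [PEquiv.toMatrix_apply, h0, Ne.symm h]

theorem mix_one {Ω : Type*} {n : ℕ} (x : Ω → Fin n → ℝ) : mix 1 x = x := by
  funext ω
  simp [mix]

theorem mix_mix {Ω : Type*} {n : ℕ} (A B : Matrix (Fin n) (Fin n) ℝ) (x : Ω → Fin n → ℝ) :
    mix A (mix B x) = mix (A * B) x := by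
  funext ω
  simp [mix]

theorem mix_monomial {Ω : Type*} {n : ℕ} (d : Fin n → ℝ) (σ : Equiv.Perm (Fin n)) (x : Ω → Fin n → ℝ) :
    mix (Matrix.diagonal d * σ.permMatrix ℝ) x = fun ω => monomialMap d σ 0 (x ω) := by
  funext ω
  rw [monomialMap_eq, add_zero]
  rfl

theorem IsScaleInvariant.isRelativelyScaleInvariant {Ω : Type*} {n : ℕ} {𝒳 : Set (Ω → Fin n → ℝ)}
    {Ψ : (Ω → Fin n → ℝ) → ℝ} (h : IsScaleInvariant 𝒳 Ψ) : IsRelativelyScaleInvariant 𝒳 Ψ :=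
  ⟨fun _ => 1, fun d hd x hx => by rw [h d hd x hx, one_mul]⟩

theorem one_mem_linearFilters {n : ℕ} : (1 : Matrix (Fin n) (Fin n) ℝ) ∈ linearFilters n := by
  simp [linearFilters]

theorem trivialFilters_subset {n : ℕ} : trivialFilters n ⊆ linearFilters n := by
  rintro _ ⟨d, σ, hd, rfl⟩
  exact det_monomial_ne_zero hd σ

theorem mul_mem_linearFilters {n : ℕ} {A B : Matrix (Fin n) (Fin n) ℝ} (hA : A ∈ linearFilters n)
    (hB : B ∈ linearFilters n) : A * B ∈ linearFilters n := by
  simpa [linearFilters, Matrix.det_mul] using ⟨hA, hB⟩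

variable {Ω : Type*} [MeasurableSpace Ω] {P : Measure Ω} {n : ℕ}

/-- Zero variance would concentrate the law at one point, which a law with a density does not
charge. -/
theorem variance_ne_zero_of_isDiffPDF [IsProbabilityMeasure P] {X : Ω → ℝ} (hX : MemLp X 2 P)
    {f : ℝ → ℝ} (hf : IsDiffPDF (P.map X) f) : variance X P ≠ 0 := by
  intro h
  have h1 := ae_eq_integral_of_variance_eq_zero hX h
  have hXm := hX.1.aemeasurable
  have h2 : P.map X {∫ ω, X ω ∂P} = 1 := by
    rw [Measure.map_apply_of_aemeasurable hXm (measurableSet_singleton _)]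
    exact (prob_compl_eq_zero_iff₀ (hXm.nullMeasurable (measurableSet_singleton _))).1 h1
  rw [hf.2.2, withDensity_absolutelyContinuous _ _ (by simp)] at h2
  exact zero_ne_one h2

theorem memLp_mix {s : Ω → Fin n → ℝ} (hs : ∀ i, MemLp (fun ω => s ω i) 2 P)
    (H : Matrix (Fin n) (Fin n) ℝ) (i : Fin n) : MemLp (fun ω => mix H s ω i) 2 P :=
  memLp_finsetSum Finset.univ fun j _ => (hs j).const_mul (H i j)

theorem aemeasurable_of_memLp {x : Ω → Fin n → ℝ} (hx : ∀ i, MemLp (fun ω => x ω i) 2 P) :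
    AEMeasurable x P :=
  aemeasurable_pi_iff.2 fun i => (hx i).1.aemeasurable

theorem isProbabilityMeasure_map_of_memLp [IsProbabilityMeasure P] {x : Ω → Fin n → ℝ}
    (hx : ∀ i, MemLp (fun ω => x ω i) 2 P) : IsProbabilityMeasure (P.map x) :=
  Measure.isProbabilityMeasure_map (aemeasurable_of_memLp hx)

theorem marginal_map_eq {x : Ω → Fin n → ℝ} (hx : AEMeasurable x P) (i : Fin n) :
    marginal (P.map x) i = P.map fun ω => x ω i :=
  AEMeasurable.map_map_of_aemeasurable (measurable_pi_apply i).aemeasurable hx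

/-! ### Discrimination -/

theorem mem_trivialFilters_of_map_eq_pi [IsProbabilityMeasure P] {s : Ω → Fin n → ℝ}
    (hs : IsSource P s) (hpdf : ∀ i, ∃ f : ℝ → ℝ, IsDiffPDF (P.map fun ω => s ω i) f)
    {H : Matrix (Fin n) (Fin n) ℝ} (hH : H.det ≠ 0)
    (hpi : P.map (mix H s) = Measure.pi (marginal (P.map (mix H s)))) :
    H ∈ trivialFilters n := by
  set m : Fin n → ℝ := fun l => ∫ ω, s ω l ∂P with hm
  have hmix := memLp_mix hs.memLp_two H
  have hmixm := aemeasurable_of_memLp hmix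
  rw [show marginal (P.map (mix H s)) = _ from funext (marginal_map_eq hmixm)] at hpi
  have hindep := (iIndepFun_iff_map_fun_eq_pi_map (μ := P) (f := fun i ω => mix H s ω i)
    fun i => (hmix i).1.aemeasurable).2 hpi
  have hX : iIndepFun (fun l ω => s ω l - m l) P :=
    hs.indep.comp (fun l y => y - m l) fun l => measurable_id.sub_const (m l)
  have hX2 (l : Fin n) : MemLp (fun ω => s ω l - m l) 2 P :=
    (hs.memLp_two l).sub (memLp_const (m l))
  have hX0 (l : Fin n) : ∫ ω, (s ω l - m l) ∂P = 0 := by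
    rw [integral_sub ((hs.memLp_two l).integrable one_le_two) (integrable_const _)]
    simp [hm]
  have hvar (l : Fin n) : ∫ ω, (s ω l - m l) ^ 2 ∂P ≠ 0 := by
    obtain ⟨f, hf⟩ := hpdf l
    have h1 := variance_ne_zero_of_isDiffPDF (hs.memLp_two l) hf
    rwa [variance_eq_integral (hs.aemeasurable_apply l)] at h1
  have hY : iIndepFun (fun i ω => ∑ l, H i l * (s ω l - m l)) P := by
    have h1 := hindep.comp (fun i y => y - ∑ l, H i l * m l) fun i => measurable_id.sub_const _
    convert! h1 using 2 with i
    funext ω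
    simp only [mul_sub, Finset.sum_sub_distrib]
    rfl
  have hgauss (l : Fin n) (h : IsGaussian (P.map fun ω => s ω l - m l)) :
      IsGaussian (P.map fun ω => s ω l) := by
    have h1 : P.map (fun ω => s ω l) = (P.map fun ω => s ω l - m l).map fun y => y + m l := by
      rw [AEMeasurable.map_map_of_aemeasurable (by fun_prop) (hX2 l).1.aemeasurable]
      congr 1
      funext ω
      simp
    rw [h1]
    infer_instance
  refine mem_trivialFilters_of_col hH fun i k j hij hkj => ?_
  by_contra hik
  -- The second shared source `l` satisfies the same hypotheses as `j`, so a second application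
  -- makes it Gaussian as well: two distinct Gaussian sources.
  obtain ⟨hj, l, hlj, hil, hkl⟩ :=
    isGaussian_of_iIndepFun_mixture hX hX2 hX0 hvar hH hY hik hij hkj
  obtain ⟨hl, -⟩ := isGaussian_of_iIndepFun_mixture hX hX2 hX0 hvar hH hY hik hil hkl
  exact hlj (hs.gaussian_le_one l j (hgauss l hl) (hgauss j hj))

theorem IsGFDSource.exists_isDiffPDF_mix {p : ℝ} {s : Ω → Fin n → ℝ}
    (hs : IsGFDSource P p s) {H : Matrix (Fin n) (Fin n) ℝ} (hH : H ∈ linearFilters n)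
    (i : Fin n) : ∃ f : ℝ → ℝ, IsDiffPDF (P.map fun ω => mix H s ω i) f := by
  rw [← marginal_map_eq (aemeasurable_of_memLp (memLp_mix hs.memLp_two H))]
  exact (hs.hasLpGFD H hH).marg i

theorem IsGFDSource.mem_trivialFilters [IsProbabilityMeasure P] [NeZero n] {p : ℝ} (hp : 1 ≤ p)
    {s : Ω → Fin n → ℝ} (hs : IsGFDSource P p s) {H : Matrix (Fin n) (Fin n) ℝ}
    (hH : H ∈ linearFilters n) (h0 : ∀ i, gfdIntegral p (P.map (mix H s)) i = 0) :
    H ∈ trivialFilters n := by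
  have := isProbabilityMeasure_map_of_memLp (memLp_mix hs.memLp_two H)
  refine mem_trivialFilters_of_map_eq_pi hs.toIsSource (fun i => ?_) hH
    ((hs.hasLpGFD H hH).eq_pi_of_gfdIntegral_eq_zero hp h0)
  simpa only [mix_one] using hs.exists_isDiffPDF_mix one_mem_linearFilters i

/-! ### Normalization -/

/-- The standard deviations of the components. -/
def stdDev (P : Measure Ω) (x : Ω → Fin n → ℝ) (i : Fin n) : ℝ :=
  Real.sqrt (variance (fun ω => x ω i) P)

theorem normalize_eq (x : Ω → Fin n → ℝ) : normalize P x = fun ω =>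
    monomialMap (fun i => (stdDev P x i)⁻¹) 1
      (fun i => -((∫ ω, x ω i ∂P) / stdDev P x i)) (x ω) := by
  funext ω i
  simp only [normalize, monomialMap, stdDev, Equiv.Perm.one_apply]
  ring

theorem map_normalize {x : Ω → Fin n → ℝ} (hx : AEMeasurable x P) :
    P.map (normalize P x) = (P.map x).map (monomialMap (fun i => (stdDev P x i)⁻¹) 1
      (fun i => -((∫ ω, x ω i ∂P) / stdDev P x i))) := by
  rw [AEMeasurable.map_map_of_aemeasurable (measurable_monomialMap _ _ _).aemeasurable hx,
    normalize_eq]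
  rfl

theorem map_normalize_congr {x y : Ω → Fin n → ℝ} (hx : AEMeasurable x P) (hy : AEMeasurable y P)
    (h : P.map x = P.map y) : P.map (normalize P x) = P.map (normalize P y) := by
  have hint {z : Ω → Fin n → ℝ} (hz : AEMeasurable z P) (i : Fin n) :
      ∫ ω, z ω i ∂P = ∫ v, v i ∂(P.map z) :=
    (integral_map hz (measurable_pi_apply i).aestronglyMeasurable).symm
  have hvar {z : Ω → Fin n → ℝ} (hz : AEMeasurable z P) (i : Fin n) :
      stdDev P z i = Real.sqrt (variance (fun v => v i) (P.map z)) := by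
    rw [variance_map (measurable_pi_apply i).aemeasurable hz]
    rfl
  rw [map_normalize hx, map_normalize hy]
  simp only [hint hx, hint hy, hvar hx, hvar hy, h]

theorem IsGFDSource.stdDev_ne_zero [IsProbabilityMeasure P] {p : ℝ} {s : Ω → Fin n → ℝ}
    (hs : IsGFDSource P p s) {H : Matrix (Fin n) (Fin n) ℝ} (hH : H ∈ linearFilters n)
    (i : Fin n) : stdDev P (mix H s) i ≠ 0 := by
  obtain ⟨f, hf⟩ := hs.exists_isDiffPDF_mix hH i
  have h1 := variance_ne_zero_of_isDiffPDF (memLp_mix hs.memLp_two H i) hf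
  exact (Real.sqrt_pos.2 ((variance_nonneg _ _).lt_of_ne' h1)).ne'

theorem gfdCriterion_nonpos (p : ℝ) (x : Ω → Fin n → ℝ) : gfdCriterion P p x ≤ 0 := by
  rw [gfdCriterion, neg_nonpos, gfdNorm_eq]
  exact Real.rpow_nonneg (Finset.sum_nonneg fun i _ => gfdIntegral_nonneg _ _ _) _

theorem gfdNorm_eq_zero_iff {p : ℝ} (hp : 1 ≤ p) (μ : Measure (Fin n → ℝ)) :
    gfdNorm p μ = 0 ↔ ∀ i, gfdIntegral p μ i = 0 := by
  rw [gfdNorm_eq, Real.rpow_eq_zero (Finset.sum_nonneg fun i _ => gfdIntegral_nonneg _ _ _)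
    (by positivity), Finset.sum_eq_zero_iff_of_nonneg fun i _ => gfdIntegral_nonneg _ _ _]
  simp

/-- Normalization multiplies each integral by a positive factor, so vanishing can be tested on the
unnormalized mixture. -/
theorem IsGFDSource.gfdCriterion_eq_zero_iff [IsProbabilityMeasure P] {p : ℝ} (hp : 1 ≤ p)
    {s : Ω → Fin n → ℝ} (hs : IsGFDSource P p s) {H : Matrix (Fin n) (Fin n) ℝ}
    (hH : H ∈ linearFilters n) :
    gfdCriterion P p (mix H s) = 0 ↔ ∀ i, gfdIntegral p (P.map (mix H s)) i = 0 := by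
  have hd (i : Fin n) : (stdDev P (mix H s) i)⁻¹ ≠ 0 := inv_ne_zero (hs.stdDev_ne_zero hH i)
  rw [gfdCriterion, neg_eq_zero, gfdNorm_eq_zero_iff hp,
    map_normalize (aemeasurable_of_memLp (memLp_mix hs.memLp_two H))]
  refine forall_congr' fun i => ?_
  rw [(hs.hasLpGFD H hH).hasDiffPDFs.gfdIntegral_monomialMap p hd, Equiv.Perm.one_apply,
    mul_eq_zero, or_iff_right]
  exact (mul_pos (Real.rpow_pos_of_pos (Finset.prod_pos fun i _ => abs_pos.2 (hd i)) _)
    (Real.rpow_pos_of_pos (abs_pos.2 (hd i)) _)).ne'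

theorem IsGFDSource.gfdIntegral_eq_zero [IsProbabilityMeasure P] {p : ℝ} (hp : 1 ≤ p)
    {s : Ω → Fin n → ℝ} (hs : IsGFDSource P p s) (i : Fin n) :
    gfdIntegral p (P.map s) i = 0 := by
  have (i : Fin n) : IsProbabilityMeasure (P.map fun ω => s ω i) :=
    Measure.isProbabilityMeasure_map (hs.aemeasurable_apply i)
  have h1 := (hs.hasLpGFD 1 one_mem_linearFilters).hasDiffPDFs
  rw [mix_one, map_eq_pi_of_iIndepFun hs.aemeasurable_apply hs.indep] at h1
  rw [map_eq_pi_of_iIndepFun hs.aemeasurable_apply hs.indep, gfdIntegral]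
  simp only [gfd_pi_eq_zero h1, abs_zero, Real.zero_rpow (by linarith : p ≠ 0), integral_zero]

theorem IsGFDSource.gfdCriterion_eq_zero [IsProbabilityMeasure P] {p : ℝ} (hp : 1 ≤ p)
    {s : Ω → Fin n → ℝ} (hs : IsGFDSource P p s) : gfdCriterion P p s = 0 := by
  have h1 := hs.gfdCriterion_eq_zero_iff hp one_mem_linearFilters
  rw [mix_one] at h1
  exact h1.2 (hs.gfdIntegral_eq_zero hp)

/-- Dividing by the standard deviation cancels each scale up to its sign. -/
theorem normalize_monomial (x : Ω → Fin n → ℝ) (d : Fin n → ℝ) (σ : Equiv.Perm (Fin n)) :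
    normalize P (mix (Matrix.diagonal d * σ.permMatrix ℝ) x)
      = fun ω => monomialMap (fun i => d i / |d i|) σ 0 (normalize P x ω) := by
  rw [mix_monomial]
  funext ω i
  simp only [normalize, monomialMap, Pi.zero_apply, add_zero]
  rw [integral_const_mul, variance_const_mul, Real.sqrt_mul (sq_nonneg _), Real.sqrt_sq_eq_abs,
    ← mul_sub, mul_div_mul_comm]

theorem IsGFDSource.gfdCriterion_monomial [IsProbabilityMeasure P] {p : ℝ}
    {s : Ω → Fin n → ℝ} (hs : IsGFDSource P p s) {H : Matrix (Fin n) (Fin n) ℝ}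
    (hH : H ∈ linearFilters n) {d : Fin n → ℝ} (hd : ∀ i, d i ≠ 0) (σ : Equiv.Perm (Fin n)) :
    gfdCriterion P p (mix (Matrix.diagonal d * σ.permMatrix ℝ) (mix H s))
      = gfdCriterion P p (mix H s) := by
  have hm := aemeasurable_of_memLp (memLp_mix hs.memLp_two H)
  have hsd (i : Fin n) : (stdDev P (mix H s) i)⁻¹ ≠ 0 := inv_ne_zero (hs.stdDev_ne_zero hH i)
  have hpdf : HasDiffPDFs (P.map (normalize P (mix H s))) := by
    rw [map_normalize hm]
    exact (hs.hasLpGFD H hH).hasDiffPDFs.map_monomialMap hsd _ _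
  have hnm : AEMeasurable (normalize P (mix H s)) P := by
    rw [normalize_eq]
    exact (measurable_monomialMap _ _ _).comp_aemeasurable hm
  have hmap : P.map (normalize P (mix (Matrix.diagonal d * σ.permMatrix ℝ) (mix H s)))
      = (P.map (normalize P (mix H s))).map (monomialMap (fun i => d i / |d i|) σ 0) := by
    rw [normalize_monomial, AEMeasurable.map_map_of_aemeasurable
      (measurable_monomialMap _ _ _).aemeasurable hnm]
    rfl
  have habs (i : Fin n) : |d i / (|d i|)| = 1 := by
    rw [abs_div, abs_abs, div_self (abs_ne_zero.2 (hd i))]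
  have hne (i : Fin n) : d i / |d i| ≠ 0 := by
    rw [← abs_ne_zero, habs]
    exact one_ne_zero
  rw [gfdCriterion, gfdCriterion, gfdNorm_eq, gfdNorm_eq, hmap]
  simp only [hpdf.gfdIntegral_monomialMap p hne, habs, Finset.prod_const_one, Real.one_rpow,
    one_mul]
  rw [Equiv.sum_comp σ]

/-- The normalized criterion is a contrast. -/
theorem isContrast_gfdCriterion [IsProbabilityMeasure P] [NeZero n] {p : ℝ} (hp : 1 ≤ p)
    {𝒮 : Set (Ω → Fin n → ℝ)} (h𝒮 : ∀ s ∈ 𝒮, IsGFDSource P p s) :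
    IsContrast P (linearFilters n) (trivialFilters n) 𝒮
      (fun H x => gfdCriterion P p (mix H x)) where
  one_mem := one_mem_linearFilters
  trivial_subset := trivialFilters_subset
  sources_indep s hs := (h𝒮 s hs).indep
  law_only := by
    rintro H - x ⟨A, -, s, hs, rfl⟩ x' ⟨A', -, s', hs', rfl⟩ h
    have hm := memLp_mix (h𝒮 s hs).memLp_two A
    have hm' := memLp_mix (h𝒮 s' hs').memLp_two A'
    simp only [gfdCriterion]
    rw [map_normalize_congr (aemeasurable_of_memLp (memLp_mix hm H))
      (aemeasurable_of_memLp (memLp_mix hm' H))]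
    rw [map_mix (aemeasurable_of_memLp hm), map_mix (aemeasurable_of_memLp hm'), h]
  invariance := by
    rintro x ⟨A, hA, s, hs, rfl⟩ T ⟨d, σ, hd, rfl⟩
    simp only [mix_one]
    exact (h𝒮 s hs).gfdCriterion_monomial hA hd σ
  dominance s hs H _ := by
    simp only [mix_one, (h𝒮 s hs).gfdCriterion_eq_zero hp]
    exact gfdCriterion_nonpos p _
  discrimination s hs H hH h := by
    simp only [mix_one, (h𝒮 s hs).gfdCriterion_eq_zero hp] at h
    exact (h𝒮 s hs).mem_trivialFilters hp hH (((h𝒮 s hs).gfdCriterion_eq_zero_iff hp hH).1 h)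

/-! ### The criterion without normalization -/

theorem transvection_notMem_trivialFilters {i j : Fin n} (hij : i ≠ j) :
    Matrix.transvection i j (1 : ℝ) ∉ trivialFilters n := by
  rintro ⟨d, σ, -, h⟩
  have hne {a b : Fin n} (hab : (Matrix.diagonal d * σ.permMatrix ℝ) a b ≠ 0) : σ a = b := by
    by_contra h'
    exact hab (by simp [Matrix.diagonal_mul, PEquiv.toMatrix_apply, h'])
  have h1 : σ i = i := hne (by rw [← h]; simp [Matrix.transvection, hij.symm])
  have h2 : σ i = j := hne (by rw [← h]; simp [Matrix.transvection, hij])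
  exact hij (h1.symm.trans h2)

theorem IsGFDSource.gfdIntegral_monomial [IsProbabilityMeasure P] {p : ℝ}
    {s : Ω → Fin n → ℝ} (hs : IsGFDSource P p s) {H : Matrix (Fin n) (Fin n) ℝ}
    (hH : H ∈ linearFilters n) {d : Fin n → ℝ} (hd : ∀ i, d i ≠ 0) (σ : Equiv.Perm (Fin n))
    (i : Fin n) :
    gfdIntegral p (P.map (mix (Matrix.diagonal d * σ.permMatrix ℝ) (mix H s))) i
      = (∏ i, |d i|) ^ (1 - p) * |d i| ^ (-p) * gfdIntegral p (P.map (mix H s)) (σ i) := by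
  rw [← (hs.hasLpGFD H hH).hasDiffPDFs.gfdIntegral_monomialMap p hd σ 0 i, mix_monomial,
    AEMeasurable.map_map_of_aemeasurable (measurable_monomialMap _ _ _).aemeasurable
      (aemeasurable_of_memLp (memLp_mix hs.memLp_two H))]
  rfl

/-- On the sources themselves the criterion is zero and gives no contradiction. The supposed factor
`k` is confronted with permuted and rescaled mixtures, and the final witness is a transvection,
which is invertible but not trivial. -/
theorem not_isRelativelyScaleInvariant_rawGFDCriterion [IsProbabilityMeasure P] (hn : 2 ≤ n)
    {p : ℝ} (hp : 1 ≤ p) {𝒮 : Set (Ω → Fin n → ℝ)} (h𝒮 : ∀ s ∈ 𝒮, IsGFDSource P p s)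
    (hne : 𝒮.Nonempty) :
    ¬ IsRelativelyScaleInvariant (mixtures (linearFilters n) 𝒮) (rawGFDCriterion P p) := by
  rintro ⟨k, hk⟩
  have : NeZero n := ⟨by omega⟩
  obtain ⟨s, hs⟩ := hne
  have hs' := h𝒮 s hs
  let i₀ : Fin n := ⟨0, by omega⟩
  let i₁ : Fin n := ⟨1, by omega⟩
  have hi : i₀ ≠ i₁ := by simp [i₀, i₁]
  let a (H : Matrix (Fin n) (Fin n) ℝ) (i : Fin n) : ℝ := gfdIntegral p (P.map (mix H s)) i
  have ha0 (H i) : 0 ≤ a H i := gfdIntegral_nonneg _ _ _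
  -- Doubling only the coordinate `i₀` multiplies its integral by `c * q` with `q < 1`, and every
  -- other integral by `c`.
  let d : Fin n → ℝ := fun i => if i = i₀ then 2 else 1
  have hd (i : Fin n) : d i ≠ 0 := by
    simp only [d]
    split_ifs <;> norm_num
  set c : ℝ := (∏ i, |d i|) ^ (1 - p) with hc
  have hc0 : c ≠ 0 :=
    (Real.rpow_pos_of_pos (Finset.prod_pos fun i _ => abs_pos.2 (hd i)) _).ne'
  set q : ℝ := 2 ^ (-p) with hq
  have hq1 : q < 1 := Real.rpow_lt_one_of_one_lt_of_neg one_lt_two (by linarith)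
  have hdq (i : Fin n) : |d i| ^ (-p) = if i = i₀ then q else 1 := by
    simp only [d, hq]
    split_ifs <;> simp
  have hDmem : Matrix.diagonal d ∈ linearFilters n := by
    have h1 := det_monomial_ne_zero hd 1
    rwa [Matrix.permMatrix_one, mul_one] at h1
  have haD (H) (hH : H ∈ linearFilters n) (i : Fin n) :
      a (Matrix.diagonal d * H) i = c * (if i = i₀ then q else 1) * a H i := by
    have h1 := hs'.gfdIntegral_monomial hH hd 1 i
    rw [Matrix.permMatrix_one, mul_one, mix_mix, hdq, Equiv.Perm.one_apply] at h1
    exact h1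
  have haσ (H) (hH : H ∈ linearFilters n) (σ : Equiv.Perm (Fin n)) (i : Fin n) :
      a ((Matrix.diagonal 1 * σ.permMatrix ℝ) * H) i = a H (σ i) := by
    have h1 := hs'.gfdIntegral_monomial hH (d := 1) (fun i => one_ne_zero) σ i
    rw [mix_mix] at h1
    simpa using h1
  have hrel (H) (hH : H ∈ linearFilters n) :
      c * ((q - 1) * a H i₀ + ∑ i, a H i) = |k d| ^ p * ∑ i, a H i := by
    have h1 := hk d hd (mix H s) ⟨H, hH, s, hs, rfl⟩
    have hS0 (H) : 0 ≤ ∑ i, a H i := Finset.sum_nonneg fun i _ => ha0 H i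
    rw [mix_mix, rawGFDCriterion, rawGFDCriterion, gfdNorm_eq, gfdNorm_eq, mul_neg,
      neg_inj] at h1
    change (∑ i, a (Matrix.diagonal d * H) i) ^ (1 / p) = k d * (∑ i, a H i) ^ (1 / p) at h1
    have h2 := congrArg (fun t => |t| ^ p) h1
    simp only [abs_mul] at h2
    rw [Real.mul_rpow (abs_nonneg _) (abs_nonneg _),
      abs_of_nonneg (Real.rpow_nonneg (hS0 _) _), abs_of_nonneg (Real.rpow_nonneg (hS0 _) _),
      ← Real.rpow_mul (hS0 _), ← Real.rpow_mul (hS0 _), one_div_mul_cancel (by linarith),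
      Real.rpow_one, Real.rpow_one] at h2
    rw [← h2]
    simp only [haD H hH]
    have h3 (i : Fin n) : c * (if i = i₀ then q else 1) * a H i
        = c * a H i + if i = i₀ then c * (q - 1) * a H i₀ else 0 := by
      by_cases hi : i = i₀
      · simp only [hi, if_true]
        ring
      · simp [hi]
    simp only [h3]
    rw [Finset.sum_add_distrib, Finset.sum_ite_eq' Finset.univ i₀, if_pos (Finset.mem_univ i₀),
      ← Finset.mul_sum]
    ring
  -- Swapping rows `i₀` and `i` of `H` keeps the sum of the integrals but moves `a H i` to position
  -- `i₀`; comparing the two instances of `hrel` gives equality.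
  have hconst (H) (hH : H ∈ linearFilters n) (i : Fin n) : a H i = a H i₀ := by
    have hmem : (Matrix.diagonal 1 * (Equiv.swap i₀ i).permMatrix ℝ) * H ∈ linearFilters n :=
      mul_mem_linearFilters (det_monomial_ne_zero (fun _ => one_ne_zero) _) hH
    have h1 := hrel _ hmem
    simp only [haσ H hH, Equiv.swap_apply_left] at h1
    rw [Equiv.sum_comp (Equiv.swap i₀ i) (a H)] at h1
    have h2 := mul_left_cancel₀ hc0 (h1.trans (hrel H hH).symm)
    exact mul_left_cancel₀ (sub_ne_zero.2 hq1.ne) (add_right_cancel h2)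
  -- Equality of the integrals holds for `diagonal d * H` too, so `q * a H i₀ = a H i₀`, with `q <
  -- 1`.
  have hzero (H) (hH : H ∈ linearFilters n) : a H i₀ = 0 := by
    have h1 := hconst _ (mul_mem_linearFilters hDmem hH) i₁
    rw [haD H hH, haD H hH, if_pos rfl, if_neg hi.symm, hconst H hH i₁, mul_one, mul_assoc] at h1
    have h2 := mul_left_cancel₀ hc0 h1
    nlinarith [ha0 H i₀]
  have hT : Matrix.transvection i₀ i₁ (1 : ℝ) ∈ linearFilters n := by
    simp [linearFilters, Matrix.det_transvection_of_ne _ _ hi]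
  exact transvection_notMem_trivialFilters hi (hs'.mem_trivialFilters hp hT fun i =>
    (hconst _ hT i).trans (hzero _ hT))

theorem IsContrast.isScaleInvariant {ℋ : Set (Matrix (Fin n) (Fin n) ℝ)}
    {𝒮 : Set (Ω → Fin n → ℝ)} {Ψ : (Ω → Fin n → ℝ) → ℝ}
    (h : IsContrast P ℋ (trivialFilters n) 𝒮 fun H x => Ψ (mix H x)) :
    IsScaleInvariant (mixtures ℋ 𝒮) Ψ := fun d hd x hx => by
  have h1 := h.invariance x hx (Matrix.diagonal d) ⟨d, 1, hd, by simp⟩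
  rwa [mix_one] at h1

end

end BSS

theorem mainTheorem10 {Ω : Type*} [MeasurableSpace Ω] (P : MeasureTheory.Measure Ω)
    [MeasureTheory.IsProbabilityMeasure P] {n : ℕ} (hn : 2 ≤ n) (p : ℝ) (hp : 1 ≤ p) :
    -- the criterion is defined and finite on the mixtures of sources with regular densities
    (∀ s : Ω → Fin n → ℝ, BSS.IsSource P s →
      (∀ i, ∃ f : ℝ → ℝ, BSS.IsDiffPDF (P.map (fun ω => s ω i)) f ∧
        MeasureTheory.MemLp (deriv f) (ENNReal.ofReal p) MeasureTheory.volume) →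
      BSS.IsGFDSource P p s) ∧
    ∀ 𝒮 : Set (Ω → Fin n → ℝ), (∀ s ∈ 𝒮, BSS.IsGFDSource P p s) →
      -- with normalization it is a contrast
      BSS.IsContrast P (BSS.linearFilters n) (BSS.trivialFilters n) 𝒮
        (fun H x => BSS.gfdCriterion P p (BSS.mix H x)) ∧
      -- without normalization it is not
      (𝒮.Nonempty →
        ¬ BSS.IsScaleInvariant (BSS.mixtures (BSS.linearFilters n) 𝒮)
            (BSS.rawGFDCriterion P p) ∧
        ¬ BSS.IsRelativelyScaleInvariant (BSS.mixtures (BSS.linearFilters n) 𝒮)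
            (BSS.rawGFDCriterion P p) ∧
        ¬ BSS.IsContrast P (BSS.linearFilters n) (BSS.trivialFilters n) 𝒮
            (fun H x => BSS.rawGFDCriterion P p (BSS.mix H x))) := by
  have : NeZero n := ⟨by omega⟩
  refine ⟨fun s hs h => hs.isGFDSource hp h, fun 𝒮 h𝒮 =>
    ⟨BSS.isContrast_gfdCriterion hp h𝒮, fun hne => ?_⟩⟩
  have h1 := BSS.not_isRelativelyScaleInvariant_rawGFDCriterion hn hp h𝒮 hne
  exact ⟨fun h => h1 h.isRelativelyScaleInvariant, h1,
    fun h => h1 h.isScaleInvariant.isRelativelyScaleInvariant⟩
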